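/- **Setting.** Let $\mathscr H$ be a separable complex Hilbert space, $\mathscr M\subset\mathscr B(\mathscr H)$ a von Neumann algebra and $\rho$ a faithful normal semifinite trace on $\mathscr M$. Let $\mathscr P$ be the set of selfadjoint projections $P\in\mathscr M$ with $\rho(P)<\infty$, let $\mathscr R=\{x\in\mathscr M : xP=x \text{ for some } P\in\mathscr P\}$ be the set of elements of finite trace-rank, and let $\mathscr R_1^+=\{a\in\mathscr R : 0\le a\le I\}$. Put $|x|_1=\rho(|x|)$, $L^1(\mathscr M,\rho)\cap\mathscr M=\{x\in\mathscr M : |x|_1<\infty\}$, and, for $x\in\mathscr M$ and $t>0$, $\mu(t,x)=\inf\{\|x(I-P)\| : P\in\mathscr P,\ \rho(P)\le t\}$. Let $|\cdot|_{\mathscr J}$ be a norm on $L^1(\mathscr M,\rho)\cap\mathscr M$ such that 1. if $\mu(t,x)\le\mu(t,y)$ for all $t>0$, then $|x|_{\mathscr J}\le|y|_{\mathscr J}$; 2. there are constants $C_1,C_2\in(0,\infty)$ with $C_1\min(|x|_1,\|x\|)\le|x|_{\mathscr J}\le C_2(|x|_1+\|x\|)$ for all $x\in L^1(\mathscr M,\rho)\cap\mathscr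 M$; 3. if $P_m\in\mathscr P$ and $\rho(P_m)\to0$, then $|P_m|_{\mathscr J}\to0$. Let $\tau=(T_j)_{1\le j\le n}$ be an $n$-tuple of elements of $\mathscr M$. For projections $P,Q\in\mathscr P$ with $PQ=0$ put $$k_{\mathscr J}(\tau;P,Q)=\inf\Big\{\max_{1\le j\le n}|[T_j,A]|_{\mathscr J} : A\in\mathscr R_1^+,\ AP=P,\ AQ=0\Big\};$$ for arbitrary projections $P,Q\in\mathscr M$ with $PQ=0$ let $$k_{\mathscr J}(\tau;P,Q)=\sup\{k_{\mathscr J}(\tau;P',Q') : P',Q'\in\mathscr P,\ P'\le P,\ Q'\le Q\}\in[0,\infty],$$ and $k_{\mathscr J}(\tau;P)=k_{\mathscr J}(\tau;P,0)$. **Proposition 6.1.** Let $B_m\in\mathscr R$ $(m\in\mathbb N)$ with $B_m\ge0$ converge to $B\in\mathscr B(\mathscr H)$ in the weak operator topology, and assume $$\lim_{m\to\infty}\ \max_{1\le j\le n}|[T_j,B_m]|_{\mathscr J}=0 .$$ Let $F$ be the support projection of $B$, that is, the spectral projection of $B$ for $(0,\infty)$, or equivalently the orthogonal projection onto $(\ker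 B)^\perp$. Then $F\in\mathscr M$, $[T_j,F]=0$ for $1\le j\le n$, and $$k_{\mathscr J}(\tau;F)=0 .$$ -/

import Mathlib

open Filter Topology
open scoped ENNReal NNReal

namespace QuasicentralModulus

variable {H : Type*} [NormedAddCommGroup H] [InnerProductSpace ℂ H] [CompleteSpace H]

/-- A faithful normal semifinite trace on the von Neumann algebra `M`.  The weight is a function
`M₊ → [0, ∞]`; it is stored as a function on all operators, but only its values on the positive
elements of `M` are constrained, and only these values are used below. -/
structure Trace (M : VonNeumannAlgebra H) where
  toFun : (H →L[ℂ] H) → ℝ≥0∞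
  map_add' : ∀ x ∈ M, ∀ y ∈ M, 0 ≤ x → 0 ≤ y → toFun (x + y) = toFun x + toFun y
  map_smul' : ∀ (c : ℝ≥0), ∀ x ∈ M, 0 ≤ x → toFun (((c : ℝ) : ℂ) • x) = c * toFun x
  tracial' : ∀ x ∈ M, toFun (star x * x) = toFun (x * star x)
  faithful' : ∀ x ∈ M, 0 ≤ x → toFun x = 0 → x = 0
  /-- Normality: the trace preserves suprema of bounded upward directed families in `M₊`. -/
  normal' : ∀ (D : Set (H →L[ℂ] H)) (x : H →L[ℂ] H), D.Nonempty → DirectedOn (· ≤ ·) D →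
    (∀ y ∈ D, y ∈ M ∧ 0 ≤ y) → x ∈ M → IsLUB D x → toFun x = ⨆ y ∈ D, toFun y
  /-- Semifiniteness: every nonzero positive element dominates a nonzero positive element of
  finite trace. -/
  semifinite' : ∀ x ∈ M, 0 ≤ x → x ≠ 0 → ∃ y ∈ M, 0 ≤ y ∧ y ≤ x ∧ y ≠ 0 ∧ toFun y < ∞

instance (M : VonNeumannAlgebra H) : CoeFun (Trace M) (fun _ => (H →L[ℂ] H) → ℝ≥0∞) :=
  ⟨Trace.toFun⟩

/-- The selfadjoint projections of `M`. -/
def Proj (M : VonNeumannAlgebra H) : Set (H →L[ℂ] H) := {P | P ∈ M ∧ IsStarProjection P}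

variable {M : VonNeumannAlgebra H}

/-- The projections of `M` of finite trace. -/
def finProj (ρ : Trace M) : Set (H →L[ℂ] H) := {P | P ∈ Proj M ∧ ρ P < ∞}

/-- The ideal `𝓡` of elements of `M` of finite trace-rank. -/
def finRank (ρ : Trace M) : Set (H →L[ℂ] H) := {x | x ∈ M ∧ ∃ P ∈ finProj ρ, x * P = x}

/-- The positive contractions of finite trace-rank. -/
def finRankPosContr (ρ : Trace M) : Set (H →L[ℂ] H) := {a | a ∈ finRank ρ ∧ 0 ≤ a ∧ a ≤ 1}

/-- `L¹(M, ρ) ∩ M`. -/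
def L1 (ρ : Trace M) : Set (H →L[ℂ] H) := {x | x ∈ M ∧ ρ (CFC.abs x) < ∞}

/-- The norm `|x|₁ = ρ(|x|)` for `x ∈ L¹(M, ρ) ∩ M`. -/
noncomputable def norm1 (ρ : Trace M) (x : H →L[ℂ] H) : ℝ := (ρ (CFC.abs x)).toReal

/-- Generalized singular values
`μ(t, x) = inf {‖x (1 - P)‖ : P a projection of M with ρ(P) ≤ t}`, for `t > 0`. -/
noncomputable def singularValue (ρ : Trace M) (t : ℝ) (x : H →L[ℂ] H) : ℝ :=
  sInf {r | ∃ P ∈ finProj ρ, ρ P ≤ ENNReal.ofReal t ∧ r = ‖x * (1 - P)‖}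

/-- A symmetric operator norm `|·|_J` on `L¹(M, ρ) ∩ M`.  It is stored as a function on all
operators, but only its values on `L¹(M, ρ) ∩ M` are constrained, and only these are used. -/
structure SymmNorm (ρ : Trace M) where
  toFun : (H →L[ℂ] H) → ℝ
  nonneg' : ∀ x ∈ L1 ρ, 0 ≤ toFun x
  eq_zero' : ∀ x ∈ L1 ρ, toFun x = 0 → x = 0
  smul' : ∀ (c : ℂ), ∀ x ∈ L1 ρ, toFun (c • x) = ‖c‖ * toFun x
  add_le' : ∀ x ∈ L1 ρ, ∀ y ∈ L1 ρ, toFun (x + y) ≤ toFun x + toFun y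
  /-- The norm is monotone in the generalized singular values. -/
  mono' : ∀ x ∈ L1 ρ, ∀ y ∈ L1 ρ,
    (∀ t : ℝ, 0 < t → singularValue ρ t x ≤ singularValue ρ t y) → toFun x ≤ toFun y
  /-- `C₁ min(|x|₁, ‖x‖) ≤ |x|_J ≤ C₂ (|x|₁ + ‖x‖)`. -/
  bounds' : ∃ C₁ C₂ : ℝ, 0 < C₁ ∧ 0 < C₂ ∧ ∀ x ∈ L1 ρ,
    C₁ * min (norm1 ρ x) ‖x‖ ≤ toFun x ∧ toFun x ≤ C₂ * (norm1 ρ x + ‖x‖)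
  /-- Projections whose trace tends to zero tend to zero in `|·|_J`. -/
  tendsto_zero' : ∀ P : ℕ → (H →L[ℂ] H), (∀ m, P m ∈ finProj ρ) →
    Tendsto (fun m => ρ (P m)) atTop (𝓝 0) → Tendsto (fun m => toFun (P m)) atTop (𝓝 0)

instance (ρ : Trace M) : CoeFun (SymmNorm ρ) (fun _ => (H →L[ℂ] H) → ℝ) := ⟨SymmNorm.toFun⟩

variable {ρ : Trace M} {n : ℕ}

/-- `max_j |[T_j, A]|_J`, as an element of `[0, ∞]` (and `0` for the empty tuple). -/
noncomputable def maxCommNorm (J : SymmNorm ρ) (T : Fin n → (H →L[ℂ] H)) (A : H →L[ℂ] H) :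
    ℝ≥0∞ :=
  ⨆ j, ENNReal.ofReal (J (T j * A - A * T j))

/-- The condenser quasicentral modulus `k_J(τ; P, Q)` of projections `P, Q` of finite trace with
`P Q = 0`: the infimum of `max_j |[T_j, A]|_J` over the positive contractions `A` of finite
trace-rank with `A P = P`, `A Q = 0`. -/
noncomputable def finModulus (J : SymmNorm ρ) (T : Fin n → (H →L[ℂ] H)) (P Q : H →L[ℂ] H) :
    ℝ≥0∞ :=
  ⨅ A ∈ {A | A ∈ finRankPosContr ρ ∧ A * P = P ∧ A * Q = 0}, maxCommNorm J T A

/-- The condenser quasicentral modulus `k_J(τ; P, Q) ∈ [0, ∞]` of arbitrary projections `P, Q` of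
`M` with `P Q = 0`: the supremum over the subprojections of finite trace. -/
noncomputable def condenserModulus (J : SymmNorm ρ) (T : Fin n → (H →L[ℂ] H))
    (P Q : H →L[ℂ] H) : ℝ≥0∞ :=
  ⨆ P' ∈ {P' | P' ∈ finProj ρ ∧ P' ≤ P}, ⨆ Q' ∈ {Q' | Q' ∈ finProj ρ ∧ Q' ≤ Q},
    finModulus J T P' Q'

/-- `k_J(τ; P) = k_J(τ; P, 0)`. -/
noncomputable def modulus (J : SymmNorm ρ) (T : Fin n → (H →L[ℂ] H)) (P : H →L[ℂ] H) : ℝ≥0∞ :=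
  condenserModulus J T P 0

/-- The support projection of a positive operator `B`, i.e. the orthogonal projection onto
`(ker B)ᗮ`; this is the spectral projection of `B` for `(0, ∞)`. -/
noncomputable def supportProj (B : H →L[ℂ] H) : H →L[ℂ] H := B.kerᗮ.starProjection

end QuasicentralModulus

open scoped InnerProductSpace ComplexOrder

namespace QuasicentralModulus

variable {H : Type*} [NormedAddCommGroup H] [InnerProductSpace ℂ H]

/-! The function t ↦ st/(1 + st) = 1 - (1 + st)⁻¹ turns approximately commuting positive operators
into approximately commuting positive contractions, since [T, 1 - (1 + b)⁻¹] = (1 + b)⁻¹ [T, b] (1 +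
b)⁻¹. Applied to B, it increases strongly to F as s → ∞.

Commutation: the lower bound on the norm splits the commutators [T_j, B_m], along a subsequence,
into terms small in operator norm and terms with summable trace norms. Both kinds tend strongly to
zero, so the weak limit [T_j, B] vanishes (`SymmNorm.eq_zero_of_tendsto`), and F, a strong limit of
functions of B, commutes with T_j.

Modulus: fix P ≤ F of finite trace. Weak convergence does not pass through resolvents, so Mazur's
theorem replaces the B_m by a convex combination C that is norm close to B on finitely many vectors
and still has small commutators. Then A = 1 - (1 + sC)⁻¹ has small commutators and almost fixes
finitely many prescribed vectors of the range of F (`exists_finRankPosContr_approx`). Running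
through a dense sequence with errors 2⁻ᵏ gives A_k for which P(1 - A_k)P has summable matrix
coefficients on a dense set. A domination argument and normality make its trace tend to zero, and
Chebyshev's inequality then makes (1 - A_k)P and its adjoint tend to zero in the symmetric norm.
Hence replacing A_k by P + (1 - P)A_k(1 - P), which equals 1 on P, costs arbitrarily little
(`exists_finRankPosContr_eq_one_on`). -/

theorem nonneg_iff_inner {a : H →L[ℂ] H} : 0 ≤ a ↔ ∀ v, 0 ≤ ⟪v, a v⟫_ℂ := by
  rw [ContinuousLinearMap.nonneg_iff_isPositive, ContinuousLinearMap.isPositive_iff_complex]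
  refine forall_congr' fun v => ?_
  have e1 : (⟪a v, v⟫_ℂ).re = (⟪v, a v⟫_ℂ).re := inner_re_symm (𝕜 := ℂ) _ _
  have e2 : (⟪a v, v⟫_ℂ).im = -(⟪v, a v⟫_ℂ).im := inner_im_symm (𝕜 := ℂ) _ _
  simp [Complex.ext_iff, Complex.nonneg_iff, e1, e2, and_comm, eq_comm (a := (0 : ℝ))]

theorem re_inner_nonneg {a : H →L[ℂ] H} (h : 0 ≤ a) (v : H) : 0 ≤ (⟪v, a v⟫_ℂ).re :=
  (Complex.nonneg_iff.1 (nonneg_iff_inner.1 h v)).1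

variable [CompleteSpace H]

/-! ### Operator order, strong limits and monotone convergence. -/

section Order

theorem le_iff_inner {a b : H →L[ℂ] H} : a ≤ b ↔ ∀ v, ⟪v, a v⟫_ℂ ≤ ⟪v, b v⟫_ℂ := by
  rw [← sub_nonneg, nonneg_iff_inner]
  simp

theorem le_of_tendsto_of_le {ι : Type*} {l : Filter ι} [l.NeBot] {a b : ι → H →L[ℂ] H}
    {x y : H →L[ℂ] H} (ha : ∀ v, Tendsto (fun i => a i v) l (𝓝 (x v)))
    (hb : ∀ v, Tendsto (fun i => b i v) l (𝓝 (y v))) (hab : ∀ᶠ i in l, a i ≤ b i) : x ≤ y := by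
  rw [le_iff_inner]
  intro v
  refine le_of_tendsto_of_tendsto (tendsto_const_nhds.inner (ha v))
    (tendsto_const_nhds.inner (hb v)) ?_
  filter_upwards [hab] with i hi using le_iff_inner.1 hi v

theorem isLUB_of_tendsto {a : ℕ → H →L[ℂ] H} {x : H →L[ℂ] H} (hm : Monotone a)
    (ha : ∀ v, Tendsto (fun i => a i v) atTop (𝓝 (x v))) : IsLUB (Set.range a) x := by
  constructor
  · rintro _ ⟨n, rfl⟩
    exact le_of_tendsto_of_le (fun v => tendsto_const_nhds) ha
      (eventually_atTop.2 ⟨n, fun m hm' => hm hm'⟩)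
  · intro y hy
    exact le_of_tendsto_of_le ha (fun v => tendsto_const_nhds)
      (Eventually.of_forall fun n => hy ⟨n, rfl⟩)

theorem smul_le_smul_one_of_norm_le {a : H →L[ℂ] H} {c : ℝ} (ha : 0 ≤ a) (h : ‖a‖ ≤ c) :
    a ≤ c • (1 : H →L[ℂ] H) := by
  have := (CStarAlgebra.norm_le_iff_le_algebraMap a ((norm_nonneg _).trans h) ha).1 h
  rwa [Algebra.algebraMap_eq_smul_one] at this

theorem norm_le_of_le_smul_one {a : H →L[ℂ] H} {c : ℝ} (hc : 0 ≤ c) (ha : 0 ≤ a)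
    (h : a ≤ c • (1 : H →L[ℂ] H)) : ‖a‖ ≤ c := by
  rw [← Algebra.algebraMap_eq_smul_one] at h
  exact (CStarAlgebra.norm_le_iff_le_algebraMap a hc ha).2 h

/-- A positive operator `a ≤ c` satisfies `a² ≤ c a`. -/
theorem norm_apply_sq_le {a : H →L[ℂ] H} {c : ℝ} (ha : 0 ≤ a) (h : a ≤ c • (1 : H →L[ℂ] H))
    (v : H) : ‖a v‖ ^ 2 ≤ c * (⟪v, a v⟫_ℂ).re := by
  have hcomm : Commute a (c • (1 : H →L[ℂ] H) - a) :=
    ((Commute.one_right a).smul_right c).sub_right (Commute.refl a)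
  have h0 := ha.isSelfAdjoint
  have h1 : 0 ≤ a * (c • (1 : H →L[ℂ] H) - a) := Commute.mul_nonneg ha (sub_nonneg.2 h) hcomm
  have h2 := (Complex.nonneg_iff.1 (nonneg_iff_inner.1 h1 v)).1
  have h3 : ⟪v, a (a v)⟫_ℂ = ⟪a v, a v⟫_ℂ := by
    have := ContinuousLinearMap.adjoint_inner_left a (a v) v
    rw [← ContinuousLinearMap.star_eq_adjoint, h0.star_eq] at this
    exact this.symm
  have h4 : (⟪a v, a v⟫_ℂ).re = ‖a v‖ ^ 2 := by
    rw [inner_self_eq_norm_sq_to_K]; norm_cast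
  have h5 : (a * (c • (1 : H →L[ℂ] H) - a)) v = (c : ℂ) • a v - a (a v) := by
    simp
  rw [h5, inner_sub_right, inner_smul_right, h3, Complex.sub_re, h4, Complex.re_ofReal_mul] at h2
  linarith

theorem re_inner_mono {a b : H →L[ℂ] H} (h : a ≤ b) (v : H) :
    (⟪v, a v⟫_ℂ).re ≤ (⟪v, b v⟫_ℂ).re :=
  (Complex.le_def.1 (le_iff_inner.1 h v)).1

/-- A decreasing sequence of positive operators converges strongly. -/
theorem exists_tendsto_of_antitone {a : ℕ → H →L[ℂ] H} (hm : Antitone a) (h0 : ∀ n, 0 ≤ a n) :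
    ∃ x : H →L[ℂ] H, ∀ v, Tendsto (fun n => a n v) atTop (𝓝 (x v)) := by
  have key : ∀ v, ∃ w, Tendsto (fun n => a n v) atTop (𝓝 w) := by
    intro v
    apply cauchySeq_tendsto_of_complete
    have hr : Antitone fun n => (⟪v, a n v⟫_ℂ).re := fun i j hij => re_inner_mono (hm hij) v
    have hcs : CauchySeq fun n => (⟪v, a n v⟫_ℂ).re :=
      (tendsto_atTop_ciInf hr ⟨0, by rintro _ ⟨n, rfl⟩; exact re_inner_nonneg (h0 n) v⟩).cauchySeq
    -- The quadratic forms decrease and so are Cauchy; since 0 ≤ a i - a j ≤ ‖a 0‖, they control the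
    -- differences of the vectors.
    have hb : ∀ i j, i ≤ j → ‖a i v - a j v‖ ^ 2
        ≤ ‖a 0‖ * ((⟪v, a i v⟫_ℂ).re - (⟪v, a j v⟫_ℂ).re) := by
      intro i j hij
      have h1 : 0 ≤ a i - a j := sub_nonneg.2 (hm hij)
      have h2 : a i - a j ≤ ‖a 0‖ • (1 : H →L[ℂ] H) :=
        ((sub_le_self _ (h0 j)).trans (hm (Nat.zero_le i))).trans
          (smul_le_smul_one_of_norm_le (h0 0) le_rfl)
      have := norm_apply_sq_le h1 h2 v
      simpa [inner_sub_right] using this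
    rw [Metric.cauchySeq_iff'] at hcs ⊢
    intro ε hε
    obtain ⟨N, hN⟩ := hcs (ε ^ 2 / (‖a 0‖ + 1)) (by positivity)
    refine ⟨N, fun n hn => ?_⟩
    have h1 := hN n hn
    have h2 := hb N n hn
    rw [Real.dist_eq, abs_sub_comm] at h1
    have h3 := (le_abs_self _).trans_lt h1
    rw [dist_eq_norm, ← norm_neg, neg_sub]
    have hp : 0 < ‖a 0‖ + 1 := by positivity
    have h5 : 0 ≤ (⟪v, a N v⟫_ℂ).re - (⟪v, a n v⟫_ℂ).re := sub_nonneg.2 (hr hn)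
    rw [lt_div_iff₀ hp] at h3
    have h4 : ‖a N v - a n v‖ ^ 2 < ε ^ 2 := by nlinarith
    exact lt_of_pow_lt_pow_left₀ 2 hε.le h4
  choose f hf using key
  exact ⟨continuousLinearMapOfTendsto a (tendsto_pi_nhds.2 hf), hf⟩

end Order

/-! ### Resolvents and the support projection as their strong limit. -/

section Resolvent

/-- The resolvent `(1 + b)⁻¹`. -/
noncomputable def res (b : H →L[ℂ] H) : H →L[ℂ] H := Ring.inverse (1 + b)

variable {b : H →L[ℂ] H}

theorem isStrictlyPositive_one_add (hb : 0 ≤ b) : IsStrictlyPositive (1 + b) :=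
  isStrictlyPositive_add (Or.inl ⟨IsStrictlyPositive.iff_of_unital.2 ⟨zero_le_one, isUnit_one⟩, hb⟩)

theorem res_mul (hb : 0 ≤ b) : res b * (1 + b) = 1 :=
  Ring.inverse_mul_cancel _ (isStrictlyPositive_one_add hb).isUnit

theorem mul_res (hb : 0 ≤ b) : (1 + b) * res b = 1 :=
  Ring.mul_inverse_cancel _ (isStrictlyPositive_one_add hb).isUnit

theorem commute_res {x : H →L[ℂ] H} (hb : 0 ≤ b) (h : Commute x b) : Commute x (res b) := by
  have h1 : x * (1 + b) = (1 + b) * x := ((Commute.one_right x).add_right h).eq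
  calc x * res b = (res b * (1 + b)) * x * res b := by rw [res_mul hb, one_mul]
    _ = res b * ((1 + b) * x) * res b := by simp only [mul_assoc]
    _ = res b * x * ((1 + b) * res b) := by rw [← h1]; simp only [mul_assoc]
    _ = res b * x := by rw [mul_res hb, mul_one]

theorem res_antitone {c : H →L[ℂ] H} (hb : 0 ≤ b) (h : b ≤ c) : res c ≤ res b :=
  CStarAlgebra.ringInverse_le_ringInverse (by gcongr) (isStrictlyPositive_one_add hb)

theorem res_le_one (hb : 0 ≤ b) : res b ≤ 1 := by
  simpa [res] using res_antitone le_rfl hb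

theorem res_isSelfAdjoint (hb : 0 ≤ b) : IsSelfAdjoint (res b) := by
  have h : star (res b) * (1 + b) = 1 := by
    have := congrArg star (mul_res hb)
    simpa [hb.isSelfAdjoint.star_eq] using this
  calc star (res b) = star (res b) * ((1 + b) * res b) := by rw [mul_res hb, mul_one]
    _ = res b := by rw [← mul_assoc, h, one_mul]

theorem res_nonneg (hb : 0 ≤ b) : 0 ≤ res b := by
  have h := (res_isSelfAdjoint hb).conjugate_nonneg (isStrictlyPositive_one_add hb).nonneg
  rwa [res_mul hb, one_mul] at h

theorem one_sub_res (hb : 0 ≤ b) : 1 - res b = res b * b := by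
  rw [sub_eq_iff_eq_add, ← res_mul hb, mul_add, mul_one, add_comm]

theorem one_sub_res' (hb : 0 ≤ b) : 1 - res b = b * res b := by
  rw [one_sub_res hb, (commute_res hb (Commute.refl b)).eq]

theorem one_sub_res_nonneg (hb : 0 ≤ b) : 0 ≤ 1 - res b := sub_nonneg.2 (res_le_one hb)

theorem one_sub_res_le_one (hb : 0 ≤ b) : 1 - res b ≤ 1 := sub_le_self _ (res_nonneg hb)

theorem one_sub_res_le (hb : 0 ≤ b) : 1 - res b ≤ b := by
  have : 0 ≤ b * (1 - res b) := Commute.mul_nonneg hb (one_sub_res_nonneg hb)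
    ((Commute.one_right b).sub_right (commute_res hb (Commute.refl b)))
  rw [mul_sub, mul_one, ← one_sub_res' hb] at this
  exact sub_nonneg.1 this

theorem norm_res_le (hb : 0 ≤ b) : ‖res b‖ ≤ 1 :=
  (CStarAlgebra.norm_le_one_iff_of_nonneg _ (res_nonneg hb)).2 (res_le_one hb)

/-- On [0, c] one has t ≤ (1 + c) t/(1 + t); the operator form comes from the positivity of (c - b)
b (1 + b)⁻¹. -/
theorem le_smul_one_sub_res {c : ℝ} (hb : 0 ≤ b) (h : b ≤ c • (1 : H →L[ℂ] H)) :
    b ≤ (1 + c) • (1 - res b) := by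
  have hc : Commute b (res b) := commute_res hb (Commute.refl b)
  have h1 : 0 ≤ (c • (1 : H →L[ℂ] H) - b) * (b * res b) := by
    refine Commute.mul_nonneg (sub_nonneg.2 h) ?_ ?_
    · rw [← one_sub_res' hb]; exact one_sub_res_nonneg hb
    · exact (((Commute.one_left _).smul_left c).sub_left ((Commute.refl b).mul_right hc))
  have h2 : b * (b * res b) = b - b * res b := by
    rw [← one_sub_res' hb, mul_sub, mul_one, ← one_sub_res' hb]
  rw [sub_mul, smul_mul_assoc, one_mul, h2] at h1
  rw [one_sub_res' hb, add_smul, one_smul, ← sub_nonneg]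
  convert h1 using 1
  abel

theorem ker_mul_res {v : H} (hb : 0 ≤ b) (hv : b v = 0) : res b v = v := by
  have h : (res b * (1 + b)) v = v := by rw [res_mul hb]; rfl
  simpa [hv] using h

/-- An ergodic-type argument that avoids Borel functional calculus: the contractions (1 + nb)⁻¹ fix
ker b, are O(1/n) on each vector of the range of b, and hence tend to zero on its closure (ker b)ᗮ.
-/
theorem tendsto_res_smul (hb : 0 ≤ b) (v : H) :
    Tendsto (fun n : ℕ => res ((n : ℝ) • b) v) atTop (𝓝 (v - supportProj b v)) := by
  have hnb : ∀ n : ℕ, 0 ≤ (n : ℝ) • b := fun n => smul_nonneg (Nat.cast_nonneg n) hb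
  set g : ℕ → H →L[ℂ] H := fun n => res ((n : ℝ) • b)
  have hg : ∀ n, ‖g n‖ ≤ 1 := fun n => norm_res_le (hnb n)
  have hfix : ∀ n w, b w = 0 → g n w = w := fun n w hw => ker_mul_res (hnb n) (by simp [hw])
  have hrange : ∀ w, Tendsto (fun n => g n (b w)) atTop (𝓝 0) := by
    intro w
    have h1 : ∀ n : ℕ, (n : ℝ) * ‖g n (b w)‖ ≤ ‖w‖ + ‖w‖ := by
      intro n
      have h2 : (1 - g n) w = (n : ℝ) • g n (b w) := by
        rw [one_sub_res (hnb n)]; simp [g]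
      have h3 := congrArg norm h2
      rw [norm_smul, Real.norm_natCast] at h3
      rw [← h3]
      refine (norm_sub_le _ _).trans (add_le_add le_rfl ?_)
      exact ((g n).le_opNorm w).trans (mul_le_of_le_one_left (norm_nonneg _) (hg n))
    refine squeeze_zero_norm' (a := fun n : ℕ => (‖w‖ + ‖w‖) / n) ?_
      (tendsto_const_div_atTop_nhds_zero_nat _)
    filter_upwards [eventually_gt_atTop 0] with n hn
    rw [le_div_iff₀ (by positivity), mul_comm]
    exact h1 n
  have hclosure : ∀ w ∈ b.range.topologicalClosure, Tendsto (fun n => g n w) atTop (𝓝 0) := by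
    intro w hw
    rw [Metric.tendsto_atTop]
    intro ε hε
    have hw' : w ∈ closure (b.range : Set H) := hw
    obtain ⟨_, ⟨u, rfl⟩, hu⟩ := Metric.mem_closure_iff.1 hw' (ε / 2) (by positivity)
    obtain ⟨N, hN⟩ := Metric.tendsto_atTop.1 (hrange u) (ε / 2) (by positivity)
    refine ⟨N, fun n hn => ?_⟩
    have h1 := hN n hn
    rw [dist_zero_right] at h1 ⊢
    rw [dist_eq_norm] at hu
    calc ‖g n w‖ = ‖g n (w - b u) + g n (b u)‖ := by simp
      _ ≤ ‖g n (w - b u)‖ + ‖g n (b u)‖ := norm_add_le _ _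
      _ ≤ ‖w - b u‖ + ‖g n (b u)‖ := by
        gcongr
        exact ((g n).le_opNorm _).trans (mul_le_of_le_one_left (norm_nonneg _) (hg n))
      _ < ε / 2 + ε / 2 := add_lt_add hu h1
      _ = ε := by ring
  have hperp : b.kerᗮ = b.range.topologicalClosure := by
    have h1 := ContinuousLinearMap.orthogonal_range b
    rw [← ContinuousLinearMap.star_eq_adjoint, hb.isSelfAdjoint.star_eq] at h1
    rw [← h1, Submodule.orthogonal_orthogonal_eq_closure]
  have hF : supportProj b v ∈ b.range.topologicalClosure := by
    rw [← hperp]; exact Submodule.starProjection_apply_mem _ _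
  have hk : b (v - supportProj b v) = 0 := by
    have : v - supportProj b v ∈ b.kerᗮᗮ := Submodule.sub_starProjection_mem_orthogonal v
    have hcl : IsClosed (b.ker : Set H) := b.isClosed_ker
    rw [Submodule.orthogonal_orthogonal_eq_closure, hcl.submodule_topologicalClosure_eq] at this
    exact this
  have h := (hclosure _ hF).add (tendsto_const_nhds (x := v - supportProj b v))
  rw [zero_add] at h
  refine h.congr fun n => ?_
  conv_lhs => rw [← hfix n _ hk]
  rw [← map_add, add_sub_cancel]

theorem tendsto_one_sub_res_smul (hb : 0 ≤ b) (v : H) :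
    Tendsto (fun n : ℕ => (1 - res ((n : ℝ) • b)) v) atTop (𝓝 (supportProj b v)) := by
  have := (tendsto_const_nhds (x := v)).sub (tendsto_res_smul hb v)
  rw [sub_sub_cancel] at this
  exact this

theorem monotone_one_sub_res_smul (hb : 0 ≤ b) :
    Monotone fun n : ℕ => 1 - res ((n : ℝ) • b) := by
  intro m n hmn
  exact sub_le_sub_left (res_antitone (smul_nonneg (Nat.cast_nonneg m) hb)
    (smul_le_smul_of_nonneg_right (Nat.cast_le.2 hmn) hb)) _

theorem supportProj_isStarProjection (b : H →L[ℂ] H) : IsStarProjection (supportProj b) :=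
  isStarProjection_starProjection

theorem mul_supportProj (b : H →L[ℂ] H) : b * supportProj b = b := by
  ext v
  have : v - supportProj b v ∈ b.kerᗮᗮ := Submodule.sub_starProjection_mem_orthogonal v
  have hcl : IsClosed (b.ker : Set H) := b.isClosed_ker
  rw [Submodule.orthogonal_orthogonal_eq_closure, hcl.submodule_topologicalClosure_eq] at this
  have h2 : b (v - supportProj b v) = 0 := this
  rw [map_sub, sub_eq_zero] at h2
  exact h2.symm

theorem commute_of_tendsto {a : ℕ → H →L[ℂ] H} {x y : H →L[ℂ] H}
    (ha : ∀ v w, Tendsto (fun n => ⟪w, a n v⟫_ℂ) atTop (𝓝 ⟪w, x v⟫_ℂ)) (h : ∀ n, Commute y (a n)) :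
    Commute y x := by
  have : y * x = x * y := by
    ext v
    refine ext_inner_left ℂ fun w => ?_
    have h1 := ha v (ContinuousLinearMap.adjoint y w)
    have h2 := ha (y v) w
    refine tendsto_nhds_unique (f := fun n => ⟪w, (y * a n) v⟫_ℂ) (l := atTop) ?_ ?_
    · simpa [ContinuousLinearMap.adjoint_inner_left] using h1
    · simpa only [(h _).eq] using! h2
  exact this

theorem commute_supportProj {y : H →L[ℂ] H} (hb : 0 ≤ b) (h : Commute y b) :
    Commute y (supportProj b) :=
  commute_of_tendsto (fun v _ => tendsto_const_nhds.inner (tendsto_one_sub_res_smul hb v))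
    fun n => (Commute.one_right y).sub_right
      (commute_res (smul_nonneg (Nat.cast_nonneg n) hb) (h.smul_right _))

end Resolvent

/-! ### Membership in the von Neumann algebra. -/

section VonNeumann

variable {M : VonNeumannAlgebra H}

/-- By the double commutant, limits and functions of elements of `M` stay in `M` as soon as they
inherit commutation relations. -/
theorem mem_of_commute {x : H →L[ℂ] H} (h : ∀ y ∈ M.commutant, Commute y x) : x ∈ M := by
  rw [← M.commutant_commutant, VonNeumannAlgebra.mem_commutant_iff]
  exact fun y hy => (h y hy).eq

theorem commute_of_mem {x y : H →L[ℂ] H} (hx : x ∈ M) (hy : y ∈ M.commutant) : Commute y x :=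
  ((VonNeumannAlgebra.mem_commutant_iff.1 hy) x hx).symm

theorem mem_of_tendsto_inner {a : ℕ → H →L[ℂ] H} {x : H →L[ℂ] H} (hM : ∀ n, a n ∈ M)
    (ha : ∀ v w, Tendsto (fun n => ⟪w, a n v⟫_ℂ) atTop (𝓝 ⟪w, x v⟫_ℂ)) : x ∈ M :=
  mem_of_commute fun _ hy => commute_of_tendsto ha fun n => commute_of_mem (hM n) hy

theorem mem_of_tendsto_apply {a : ℕ → H →L[ℂ] H} {x : H →L[ℂ] H} (hM : ∀ n, a n ∈ M)
    (ha : ∀ v, Tendsto (fun n => a n v) atTop (𝓝 (x v))) : x ∈ M :=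
  mem_of_tendsto_inner hM fun v _ => tendsto_const_nhds.inner (ha v)

theorem smul_mem_vN (c : ℂ) {x : H →L[ℂ] H} (hx : x ∈ M) : c • x ∈ M :=
  mem_of_commute fun _ hy => (commute_of_mem hx hy).smul_right c

theorem real_smul_mem_vN (c : ℝ) {x : H →L[ℂ] H} (hx : x ∈ M) : c • x ∈ M :=
  mem_of_commute fun _ hy => (commute_of_mem hx hy).smul_right c

theorem sqrt_mem {x : H →L[ℂ] H} (hx : x ∈ M) : CFC.sqrt x ∈ M :=
  mem_of_commute fun _ hy => ((commute_of_mem hx hy).symm.cfcₙ_nnreal _).symm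

theorem abs_mem {x : H →L[ℂ] H} (hx : x ∈ M) : CFC.abs x ∈ M :=
  sqrt_mem (mul_mem (star_mem hx) hx)

theorem cfc_real_mem {x : H →L[ℂ] H} (f : ℝ → ℝ) (hx : x ∈ M) : cfc f x ∈ M :=
  mem_of_commute fun _ hy => ((commute_of_mem hx hy).symm.cfc_real _).symm

theorem res_mem {x : H →L[ℂ] H} (h0 : 0 ≤ x) (hx : x ∈ M) : res x ∈ M :=
  mem_of_commute fun _ hy => commute_res h0 (commute_of_mem hx hy)

theorem supportProj_mem {x : H →L[ℂ] H} (h0 : 0 ≤ x) (hx : x ∈ M) : supportProj x ∈ M :=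
  mem_of_commute fun _ hy => commute_supportProj h0 (commute_of_mem hx hy)

theorem supportProj_mem_Proj {x : H →L[ℂ] H} (h0 : 0 ≤ x) (hx : x ∈ M) : supportProj x ∈ Proj M :=
  ⟨supportProj_mem h0 hx, supportProj_isStarProjection x⟩

end VonNeumann

end QuasicentralModulus

namespace QuasicentralModulus

variable {H : Type*} [NormedAddCommGroup H] [InnerProductSpace ℂ H] [CompleteSpace H]

/-! ### Compressions by projections and resolvent identities. -/

section Projections

theorem star_conjugate_mono {a b : H →L[ℂ] H} (h : a ≤ b) (c : H →L[ℂ] H) :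
    star c * a * c ≤ star c * b * c := star_left_conjugate_le_conjugate h c

theorem proj_conjugate_mono {a b P : H →L[ℂ] H} (hP : IsStarProjection P) (h : a ≤ b) :
    P * a * P ≤ P * b * P := by
  simpa [hP.isSelfAdjoint.star_eq] using star_conjugate_mono h P

theorem le_smul_proj {a P : H →L[ℂ] H} {c : ℝ} (hP : IsStarProjection P) (h0 : 0 ≤ a)
    (h : a ≤ c • (1 : H →L[ℂ] H)) (haP : a * P = a) : a ≤ c • P := by
  have h1 : P * a = a := by
    have := congrArg star haP
    rwa [star_mul, h0.isSelfAdjoint.star_eq, hP.isSelfAdjoint.star_eq] at this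
  have h2 := proj_conjugate_mono hP h
  rwa [h1, haP, mul_smul_comm, smul_mul_assoc, mul_one, hP.isIdempotentElem.eq] at h2

theorem apply_eq_zero_of_inner_eq_zero {a : H →L[ℂ] H} (h0 : 0 ≤ a) {v : H}
    (hv : (⟪v, a v⟫_ℂ).re ≤ 0) : a v = 0 := by
  have h1 := norm_apply_sq_le h0 (smul_le_smul_one_of_norm_le h0 le_rfl) v
  have h2 : ‖a‖ * (⟪v, a v⟫_ℂ).re ≤ 0 := mul_nonpos_of_nonneg_of_nonpos (norm_nonneg _) hv
  have h3 : ‖a v‖ ^ 2 = 0 := le_antisymm (h1.trans h2) (sq_nonneg _)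
  simpa using h3

theorem mul_eq_zero_of_le {a b e : H →L[ℂ] H} (h0 : 0 ≤ a) (h : a ≤ b) (he : b * e = 0) :
    a * e = 0 := by
  ext v
  apply apply_eq_zero_of_inner_eq_zero h0
  refine (re_inner_mono h (e v)).trans ?_
  have : b (e v) = 0 := DFunLike.congr_fun he v
  simp [this]

theorem isSelfAdjoint_sqrt (a : H →L[ℂ] H) : IsSelfAdjoint (CFC.sqrt a) :=
  (CFC.sqrt_nonneg a).isSelfAdjoint

theorem res_intertwine (x : H →L[ℂ] H) :
    res (x * star x) * x = x * res (star x * x) := by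
  have h1 : 0 ≤ x * star x := mul_star_self_nonneg x
  have h2 : 0 ≤ star x * x := star_mul_self_nonneg x
  calc res (x * star x) * x
      = res (x * star x) * (x * ((1 + star x * x) * res (star x * x))) := by
        rw [mul_res h2, mul_one]
    _ = (res (x * star x) * (1 + x * star x)) * x * res (star x * x) := by
        noncomm_ring
    _ = x * res (star x * x) := by rw [res_mul h1, one_mul]

theorem sqrt_res_mul_mul_sqrt_res {b : H →L[ℂ] H} (hb : 0 ≤ b) :
    CFC.sqrt (res b) * b * CFC.sqrt (res b) = 1 - res b := by
  have hc : Commute (CFC.sqrt (res b)) b :=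
    ((commute_res hb (Commute.refl b)).symm.cfcₙ_nnreal _)
  rw [hc.eq, mul_assoc, CFC.sqrt_mul_sqrt_self _ (res_nonneg hb), one_sub_res' hb]

theorem proj_mul_res_mul_proj {P : H →L[ℂ] H} (hP : IsStarProjection P) {s : ℝ} (hs : 0 ≤ s) :
    (1 + s) • (P * res (s • P) * P) = P := by
  have h := res_mul (smul_nonneg hs hP.nonneg)
  have h2 : (1 + s • P) * P = (1 + s) • P := by
    rw [add_mul, one_mul, smul_mul_assoc, hP.isIdempotentElem.eq, add_smul, one_smul]
  calc (1 + s) • (P * res (s • P) * P) = P * (res (s • P) * ((1 + s) • P)) := by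
        rw [mul_smul_comm, mul_smul_comm, mul_assoc]
    _ = P * (res (s • P) * (1 + s • P)) * P := by rw [← h2]; simp only [mul_assoc]
    _ = P := by rw [h, mul_one, hP.isIdempotentElem.eq]

end Projections

variable {M : VonNeumannAlgebra H} (ρ : Trace M)

/-! ### The trace: supports, suprema of projections, Chebyshev. -/

section Trace

theorem trace_mono {x y : H →L[ℂ] H} (hx : x ∈ M) (hy : y ∈ M) (h0 : 0 ≤ x) (h : x ≤ y) :
    ρ x ≤ ρ y := by
  have := ρ.map_add' x hx (y - x) (sub_mem hy hx) h0 (sub_nonneg.2 h)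
  rw [add_sub_cancel] at this
  rw [this]
  exact le_self_add

theorem trace_smul {x : H →L[ℂ] H} {c : ℝ} (hc : 0 ≤ c) (hx : x ∈ M) (h0 : 0 ≤ x) :
    ρ (c • x) = ENNReal.ofReal c * ρ x := by
  rw [ENNReal.ofReal_eq_coe_nnreal hc]
  exact ρ.map_smul' ⟨c, hc⟩ x hx h0

theorem trace_zero : ρ (0 : H →L[ℂ] H) = 0 := by
  simpa using trace_smul ρ le_rfl (zero_mem M) le_rfl

theorem trace_conj {x h : H →L[ℂ] H} (hx : x ∈ M) (hh : h ∈ M) (h0 : 0 ≤ h) :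
    ρ (star x * h * x) = ρ (CFC.sqrt h * (x * star x) * CFC.sqrt h) := by
  have := ρ.tracial' (CFC.sqrt h * x) (mul_mem (sqrt_mem hh) hx)
  rw [star_mul, (isSelfAdjoint_sqrt h).star_eq] at this
  calc ρ (star x * h * x) = ρ (star x * (CFC.sqrt h * CFC.sqrt h) * x) := by
        rw [CFC.sqrt_mul_sqrt_self h h0]
    _ = _ := by simpa only [mul_assoc] using this

theorem trace_eq_iSup_of_tendsto {a : ℕ → H →L[ℂ] H} {x : H →L[ℂ] H} (hm : Monotone a)
    (hM : ∀ n, a n ∈ M) (h0 : ∀ n, 0 ≤ a n)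
    (ha : ∀ v, Tendsto (fun n => a n v) atTop (𝓝 (x v))) : ρ x = ⨆ n, ρ (a n) := by
  rw [ρ.normal' (Set.range a) x (Set.range_nonempty a) (directedOn_range.2 hm.directed_le)
    (by rintro _ ⟨n, rfl⟩; exact ⟨hM n, h0 n⟩) (mem_of_tendsto_apply hM ha)
    (isLUB_of_tendsto hm ha), iSup_range]

theorem trace_sum {ι : Type*} (s : Finset ι) {a : ι → H →L[ℂ] H} (hM : ∀ i, a i ∈ M)
    (h0 : ∀ i, 0 ≤ a i) : ρ (∑ i ∈ s, a i) = ∑ i ∈ s, ρ (a i) := by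
  classical
  induction s using Finset.induction_on with
  | empty => simp [trace_zero]
  | insert i s his ih =>
    rw [Finset.sum_insert his, Finset.sum_insert his,
      ρ.map_add' _ (hM i) _ (sum_mem fun j _ => hM j) (h0 i) (Finset.sum_nonneg fun j _ => h0 j),
      ih]

/-- Normality applied to the increasing limit 1 - (1 + nb)⁻¹ ↑ supp b. Every bound on the trace of a
support below goes through this. -/
theorem trace_supportProj_le {b : H →L[ℂ] H} {C : ℝ≥0∞} (h0 : 0 ≤ b) (hb : b ∈ M)
    (h : ∀ s : ℝ, 0 ≤ s → ρ (1 - res (s • b)) ≤ C) : ρ (supportProj b) ≤ C := by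
  have hn : ∀ n : ℕ, 0 ≤ (n : ℝ) • b := fun n => smul_nonneg (Nat.cast_nonneg n) h0
  rw [trace_eq_iSup_of_tendsto ρ (monotone_one_sub_res_smul h0)
    (fun n => sub_mem (one_mem M) (res_mem (hn n) (real_smul_mem_vN _ hb)))
    (fun n => one_sub_res_nonneg (hn n)) (tendsto_one_sub_res_smul h0)]
  exact iSup_le fun n => h n (Nat.cast_nonneg n)

/-- Traciality exchanges x*x and xx*: the left side equals the trace of 1 - (1 + xx*)⁻¹, a positive
contraction living on P. This replaces the polar decomposition in comparing left and right supports.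
-/
theorem trace_one_sub_res_star_mul_le {x P : H →L[ℂ] H} (hx : x ∈ M) (hP : P ∈ Proj M)
    (hPx : P * x = x) : ρ (1 - res (star x * x)) ≤ ρ P := by
  have h1 : 0 ≤ x * star x := mul_star_self_nonneg x
  have h2 : 0 ≤ star x * x := star_mul_self_nonneg x
  have hm : x * star x ∈ M := mul_mem hx (star_mem hx)
  have e : 1 - res (star x * x) = star x * res (x * star x) * x := by
    rw [one_sub_res' h2, mul_assoc, mul_assoc, res_intertwine]
  rw [e, trace_conj ρ hx (res_mem h1 hm) (res_nonneg h1), sqrt_res_mul_mul_sqrt_res h1]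
  refine trace_mono ρ (sub_mem (one_mem M) (res_mem h1 hm)) hP.1 (one_sub_res_nonneg h1) ?_
  have hxP : star x * P = star x := by
    have := congrArg star hPx
    rwa [star_mul, hP.2.isSelfAdjoint.star_eq] at this
  have := le_smul_proj (c := 1) hP.2 (one_sub_res_nonneg h1)
    (by rw [one_smul]; exact one_sub_res_le_one h1)
    (by rw [one_sub_res h1, mul_assoc, mul_assoc, hxP])
  rwa [one_smul] at this

/-- The right support of `x` has at most the trace of a projection that dominates the left
support. -/
theorem exists_right_proj {x P : H →L[ℂ] H} (hx : x ∈ M) (hP : P ∈ finProj ρ) (hPx : P * x = x) :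
    ∃ Q ∈ finProj ρ, x * Q = x ∧ ρ Q ≤ ρ P := by
  have h2 : 0 ≤ star x * x := star_mul_self_nonneg x
  have hm : star x * x ∈ M := mul_mem (star_mem hx) hx
  have hle : ρ (supportProj (star x * x)) ≤ ρ P := by
    refine trace_supportProj_le ρ h2 hm fun s hs => ?_
    have := trace_one_sub_res_star_mul_le ρ (real_smul_mem_vN (√s) hx) hP.1
      (by rw [mul_smul_comm, hPx])
    rwa [star_smul, smul_mul_smul_comm, star_trivial, Real.mul_self_sqrt hs] at this
  refine ⟨_, ⟨supportProj_mem_Proj h2 hm, hle.trans_lt hP.2⟩, ?_, hle⟩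
  have h3 : star x * x * (1 - supportProj (star x * x)) = 0 := by
    rw [mul_sub, mul_one, mul_supportProj, sub_self]
  have h4 : x * (1 - supportProj (star x * x)) = 0 := by
    rw [← CStarRing.star_mul_self_eq_zero_iff, star_mul, mul_assoc, ← mul_assoc (star x), h3,
      mul_zero]
  rw [mul_sub, mul_one, sub_eq_zero] at h4
  exact h4.symm

theorem exists_sup_proj {P Q : H →L[ℂ] H} (hP : P ∈ finProj ρ) (hQ : Q ∈ finProj ρ) :
    ∃ R ∈ finProj ρ, P * R = P ∧ Q * R = Q := by
  have hP0 := hP.1.2.nonneg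
  have hQ0 := hQ.1.2.nonneg
  have h0 : 0 ≤ P + Q := add_nonneg hP0 hQ0
  have hm : P + Q ∈ M := add_mem hP.1.1 hQ.1.1
  have hz : (P + Q) * (1 - supportProj (P + Q)) = 0 := by
    rw [mul_sub, mul_one, mul_supportProj, sub_self]
  have aux : ∀ {E : H →L[ℂ] H}, 0 ≤ E → E ≤ P + Q → E * supportProj (P + Q) = E := by
    intro E hE hle
    have := mul_eq_zero_of_le hE hle hz
    rw [mul_sub, mul_one, sub_eq_zero] at this
    exact this.symm
  refine ⟨supportProj (P + Q), ⟨supportProj_mem_Proj h0 hm, ?_⟩,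
    aux hP0 (le_add_of_nonneg_right hQ0), aux hQ0 (le_add_of_nonneg_left hP0)⟩
  refine lt_of_le_of_lt (b := ρ P + ρ Q) ?_ (ENNReal.add_lt_top.2 ⟨hP.2, hQ.2⟩)
  refine trace_supportProj_le ρ h0 hm fun s hs => ?_
  have hs0 : 0 ≤ s • (P + Q) := smul_nonneg hs h0
  set h := res (s • (P + Q))
  have hhM : h ∈ M := res_mem hs0 (real_smul_mem_vN s hm)
  have hh0 : 0 ≤ h := res_nonneg hs0
  -- By traciality the left side is s ρ(EhE). Since h ≤ (1 + sE)⁻¹, which is 1/(1 + s) on E, it is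
  -- at most s/(1 + s) · ρ(E).
  have key : ∀ {E : H →L[ℂ] H}, E ∈ Proj M → E ≤ P + Q →
      ρ (s • (CFC.sqrt h * E * CFC.sqrt h)) ≤ ρ E := by
    intro E hE hle
    have hEs := hE.2.isSelfAdjoint.star_eq
    have hc : 0 ≤ CFC.sqrt h * E * CFC.sqrt h := (isSelfAdjoint_sqrt h).conjugate_nonneg hE.2.nonneg
    have e1 := trace_conj ρ hE.1 hhM hh0
    rw [hEs, hE.2.isIdempotentElem.eq] at e1
    have hEhE : 0 ≤ E * h * E := hE.2.isSelfAdjoint.conjugate_nonneg hh0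
    have hmem : E * h * E ∈ M := mul_mem (mul_mem hE.1 hhM) hE.1
    rw [trace_smul ρ hs (mul_mem (mul_mem (sqrt_mem hhM) hE.1) (sqrt_mem hhM)) hc, ← e1,
      ← trace_smul ρ hs hmem hEhE]
    refine trace_mono ρ (real_smul_mem_vN s hmem) hE.1 (smul_nonneg hs hEhE) ?_
    have h1 : h ≤ res (s • E) :=
      res_antitone (smul_nonneg hs hE.2.nonneg) (smul_le_smul_of_nonneg_left hle hs)
    calc s • (E * h * E) ≤ (1 + s) • (E * h * E) :=
          smul_le_smul_of_nonneg_right (by linarith) hEhE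
      _ ≤ (1 + s) • (E * res (s • E) * E) :=
          smul_le_smul_of_nonneg_left (proj_conjugate_mono hE.2 h1) (by linarith)
      _ = E := proj_mul_res_mul_proj hE.2 hs
  have e : 1 - h = s • (CFC.sqrt h * P * CFC.sqrt h) + s • (CFC.sqrt h * Q * CFC.sqrt h) := by
    rw [← sqrt_res_mul_mul_sqrt_res hs0, ← smul_add, mul_smul_comm, smul_mul_assoc]
    simp only [mul_add, add_mul, h]
  have hmem : ∀ {E : H →L[ℂ] H}, E ∈ M → s • (CFC.sqrt h * E * CFC.sqrt h) ∈ M := fun hE =>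
    real_smul_mem_vN s (mul_mem (mul_mem (sqrt_mem hhM) hE) (sqrt_mem hhM))
  have hpos : ∀ {E : H →L[ℂ] H}, 0 ≤ E → 0 ≤ s • (CFC.sqrt h * E * CFC.sqrt h) := fun hE =>
    smul_nonneg hs ((isSelfAdjoint_sqrt h).conjugate_nonneg hE)
  rw [e, ρ.map_add' _ (hmem hP.1.1) _ (hmem hQ.1.1) (hpos hP0) (hpos hQ0)]
  exact add_le_add (key hP.1 (le_add_of_nonneg_right hQ0)) (key hQ.1 (le_add_of_nonneg_left hP0))

/-- Chebyshev's inequality: a spectral projection of `a` for `(s, ∞)`. -/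
theorem exists_spectral_proj {a : H →L[ℂ] H} (ha : a ∈ M) (h0 : 0 ≤ a) {s : ℝ} (hs : 0 < s) :
    ∃ E ∈ Proj M, ENNReal.ofReal s * ρ E ≤ ρ a ∧ (1 - E) * a * (1 - E) ≤ s • (1 : H →L[ℂ] H) ∧
      ∀ y, Commute y a → Commute y E := by
  set b := cfc (fun t : ℝ => max (t - s) 0) a with hb
  -- Here b and c are the positive and negative parts of a - s, and the projection is the support of
  -- b.
  set c := cfc (fun t : ℝ => max (s - t) 0) a with hc
  have hsa := h0.isSelfAdjoint
  have hb0 : 0 ≤ b := cfc_nonneg fun _ _ => le_max_right _ _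
  have hc0 : 0 ≤ c := cfc_nonneg fun _ _ => le_max_right _ _
  have hbM : b ∈ M := cfc_real_mem _ ha
  have hbc : b * c = 0 := by
    rw [hb, hc, ← cfc_mul _ _ a, ← cfc_zero ℝ a]
    refine cfc_congr fun t _ => ?_
    rcases le_total t s with h | h
    · simp [h]
    · simp [h]
  have habc : a - s • (1 : H →L[ℂ] H) = b - c := by
    rw [hb, hc, ← cfc_sub _ _ a, ← Algebra.algebraMap_eq_smul_one, ← cfc_const s a]
    conv_lhs => enter [1]; rw [← cfc_id ℝ a]
    rw [← cfc_sub _ _ a]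
    refine cfc_congr fun t _ => ?_
    rcases le_total t s with h | h
    · simp [h]
    · simp [h]
  have hcomm : ∀ y, Commute y a → Commute y b := fun y hy => (hy.symm.cfc_real _).symm
  refine ⟨supportProj b, supportProj_mem_Proj hb0 hbM, ?_, ?_,
    fun y hy => commute_supportProj hb0 (hcomm y hy)⟩
  · have hle : ρ (supportProj b) ≤ ρ a / ENNReal.ofReal s := by
      refine trace_supportProj_le ρ hb0 hbM fun u hu => ?_
      have hu0 : 0 ≤ u • b := smul_nonneg hu hb0
      set f := 1 - res (u • b) with hf
      have hf0 : 0 ≤ f := one_sub_res_nonneg hu0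
      have hfM : f ∈ M := sub_mem (one_mem M) (res_mem hu0 (real_smul_mem_vN u hbM))
      have hfcomm : ∀ y, Commute y b → Commute y f := fun y hy =>
        (Commute.one_right y).sub_right (commute_res hu0 (hy.smul_right u))
      have hfc : f * c = 0 := by
        rw [hf, one_sub_res hu0, mul_assoc, smul_mul_assoc, hbc, smul_zero, mul_zero]
      have h1 : 0 ≤ f * b := Commute.mul_nonneg hf0 hb0 (hfcomm b (Commute.refl b)).symm
      have h2 : 0 ≤ (1 - f) * a := by
        refine Commute.mul_nonneg (sub_nonneg.2 (one_sub_res_le_one hu0)) h0 ?_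
        exact (Commute.one_left a).sub_left (hfcomm a (hcomm a (Commute.refl a))).symm
      -- As f annihilates c, f(a - s) = fb ≥ 0, whence sf ≤ fa ≤ a.
      have h3 : s • f ≤ a := by
        have : f * (a - s • (1 : H →L[ℂ] H)) = f * b := by rw [habc, mul_sub, hfc, sub_zero]
        rw [mul_sub, mul_smul_comm, mul_one] at this
        rw [← this] at h1
        rw [sub_mul, one_mul] at h2
        exact (sub_nonneg.1 h1).trans (sub_nonneg.1 h2)
      have h4 := trace_mono ρ (real_smul_mem_vN s hfM) ha (smul_nonneg hs.le hf0) h3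
      rw [trace_smul ρ hs.le hfM hf0] at h4
      rw [ENNReal.le_div_iff_mul_le (Or.inl (by simpa using hs)) (Or.inl ENNReal.ofReal_ne_top),
        mul_comm]
      exact h4
    rw [ENNReal.le_div_iff_mul_le (Or.inl (by simpa using hs)) (Or.inl ENNReal.ofReal_ne_top),
      mul_comm] at hle
    exact hle
  · have hE := (supportProj_isStarProjection b).one_sub
    have h1 : b * (1 - supportProj b) = 0 := by
      rw [mul_sub, mul_one, mul_supportProj, sub_self]
    have h2 : a ≤ s • (1 : H →L[ℂ] H) + b := by
      rw [← sub_nonneg]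
      have : s • (1 : H →L[ℂ] H) + b - a = c := by
        rw [sub_eq_iff_eq_add] at habc
        rw [habc]; abel
      rwa [this]
    calc (1 - supportProj b) * a * (1 - supportProj b)
        ≤ (1 - supportProj b) * (s • (1 : H →L[ℂ] H) + b) * (1 - supportProj b) :=
          proj_conjugate_mono hE h2
      _ = s • (1 - supportProj b) := by
          rw [mul_assoc, add_mul, h1, add_zero, smul_mul_assoc, one_mul, mul_smul_comm,
            hE.isIdempotentElem.eq]
      _ ≤ s • (1 : H →L[ℂ] H) := smul_le_smul_of_nonneg_left hE.le_one hs.le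

end Trace

/-! ### The ideal of finite trace-rank operators. -/

section FinRank

variable {ρ}

theorem finRank_add {x y : H →L[ℂ] H} (hx : x ∈ finRank ρ) (hy : y ∈ finRank ρ) :
    x + y ∈ finRank ρ := by
  obtain ⟨hxM, P, hP, hxP⟩ := hx
  obtain ⟨hyM, Q, hQ, hyQ⟩ := hy
  obtain ⟨R, hR, hPR, hQR⟩ := exists_sup_proj ρ hP hQ
  refine ⟨add_mem hxM hyM, R, hR, ?_⟩
  rw [add_mul, ← hxP, ← hyQ, mul_assoc, mul_assoc, hPR, hQR]

theorem finRank_mul_left {x T : H →L[ℂ] H} (hT : T ∈ M) (hx : x ∈ finRank ρ) :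
    T * x ∈ finRank ρ := by
  obtain ⟨hxM, P, hP, hxP⟩ := hx
  exact ⟨mul_mem hT hxM, P, hP, by rw [mul_assoc, hxP]⟩

/-- Finite trace-rank is defined by the right support; comparing supports makes it a two-sided
condition, which gives stability under adjoints and right multiplication. -/
theorem finRank_of_proj_mul {x P : H →L[ℂ] H} (hx : x ∈ M) (hP : P ∈ finProj ρ)
    (hPx : P * x = x) : x ∈ finRank ρ := by
  obtain ⟨Q, hQ, hxQ, -⟩ := exists_right_proj ρ hx hP hPx
  exact ⟨hx, Q, hQ, hxQ⟩

theorem finRank_star {x : H →L[ℂ] H} (hx : x ∈ finRank ρ) : star x ∈ finRank ρ := by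
  obtain ⟨hxM, P, hP, hxP⟩ := hx
  refine finRank_of_proj_mul (star_mem hxM) hP ?_
  have := congrArg star hxP
  rwa [star_mul, hP.1.2.isSelfAdjoint.star_eq] at this

theorem finRank_mul_right {x T : H →L[ℂ] H} (hT : T ∈ M) (hx : x ∈ finRank ρ) :
    x * T ∈ finRank ρ := by
  have := finRank_star (finRank_mul_left (star_mem hT) (finRank_star hx))
  simpa using this

theorem finRank_smul (c : ℂ) {x : H →L[ℂ] H} (hx : x ∈ finRank ρ) : c • x ∈ finRank ρ := by
  obtain ⟨hxM, P, hP, hxP⟩ := hx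
  exact ⟨smul_mem_vN c hxM, P, hP, by rw [smul_mul_assoc, hxP]⟩

theorem finRank_sub {x y : H →L[ℂ] H} (hx : x ∈ finRank ρ) (hy : y ∈ finRank ρ) :
    x - y ∈ finRank ρ := by
  have := finRank_add hx (finRank_smul (-1) hy)
  simpa [sub_eq_add_neg] using this

theorem finRank_commutator {x T : H →L[ℂ] H} (hT : T ∈ M) (hx : x ∈ finRank ρ) :
    T * x - x * T ∈ finRank ρ :=
  finRank_sub (finRank_mul_left hT hx) (finRank_mul_right hT hx)

theorem finProj_subset_finRank {P : H →L[ℂ] H} (hP : P ∈ finProj ρ) : P ∈ finRank ρ :=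
  ⟨hP.1.1, P, hP, hP.1.2.isIdempotentElem.eq⟩

/-- From x*x ≤ c²P, operator monotonicity of the square root gives |x| ≤ cP. -/
theorem trace_abs_le {x P : H →L[ℂ] H} {c : ℝ} (hx : x ∈ M) (hP : P ∈ Proj M) (hxP : x * P = x)
    (hc : ‖x‖ ≤ c) : ρ (CFC.abs x) ≤ ENNReal.ofReal c * ρ P := by
  have hc0 : 0 ≤ c := (norm_nonneg x).trans hc
  have h1 : star x * x ≤ (c ^ 2) • P := by
    refine le_smul_proj hP.2 (star_mul_self_nonneg x) ?_ (by rw [mul_assoc, hxP])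
    refine smul_le_smul_one_of_norm_le (star_mul_self_nonneg x) ?_
    rw [CStarRing.norm_star_mul_self, ← sq]
    gcongr
  have h2 : CFC.sqrt ((c ^ 2) • P) = c • P := by
    refine CFC.sqrt_unique ?_ (smul_nonneg hc0 hP.2.nonneg)
    rw [smul_mul_smul_comm, hP.2.isIdempotentElem.eq, sq]
  have h3 : CFC.abs x ≤ c • P := by
    rw [← h2]; exact CFC.sqrt_le_sqrt _ _ h1
  rw [← trace_smul ρ hc0 hP.1 hP.2.nonneg]
  exact trace_mono ρ (abs_mem hx) (real_smul_mem_vN c hP.1) (CFC.abs_nonneg x) h3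

theorem trace_abs_le' {x P : H →L[ℂ] H} {c : ℝ} (hx : x ∈ M) (hP : P ∈ finProj ρ)
    (hPx : P * x = x) (hc : ‖x‖ ≤ c) : ρ (CFC.abs x) ≤ ENNReal.ofReal c * ρ P := by
  obtain ⟨Q, hQ, hxQ, hle⟩ := exists_right_proj ρ hx hP hPx
  exact (trace_abs_le hx hQ.1 hxQ hc).trans (by gcongr)

theorem finRank_subset_L1 {x : H →L[ℂ] H} (hx : x ∈ finRank ρ) : x ∈ L1 ρ := by
  obtain ⟨hxM, P, hP, hxP⟩ := hx
  exact ⟨hxM, (trace_abs_le hxM hP.1 hxP le_rfl).trans_lt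
    (ENNReal.mul_lt_top ENNReal.ofReal_lt_top hP.2)⟩

end FinRank

end QuasicentralModulus

namespace QuasicentralModulus

variable {H : Type*} [NormedAddCommGroup H] [InnerProductSpace ℂ H] [CompleteSpace H]
variable {M : VonNeumannAlgebra H} {ρ : Trace M}

/-! ### A noncommutative Borel–Cantelli argument. -/

section Domination

/-- A uniformly bounded sequence `a` of positive operators is dominated by a decreasing sequence
`K`, where `K k` is an increasing strong limit of operators `L N ≤ ∑ m ∈ [k, k + N), a m`. -/
theorem exists_antitone_dominating {a : ℕ → H →L[ℂ] H} {c : ℝ} (haM : ∀ m, a m ∈ M)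
    (h0 : ∀ m, 0 ≤ a m) (hc0 : 0 ≤ c) (hc : ∀ m, a m ≤ c • (1 : H →L[ℂ] H)) :
    ∃ (K : ℕ → H →L[ℂ] H) (K' : H →L[ℂ] H), Antitone K ∧ (∀ k, K k ∈ M) ∧ (∀ k, 0 ≤ K k) ∧
      (∀ k, K k ≤ 1) ∧ 0 ≤ K' ∧ K' ∈ M ∧ (∀ k, K' ≤ K k) ∧
      (∀ v, Tendsto (fun k => K k v) atTop (𝓝 (K' v))) ∧
      (∀ m, a m ≤ (1 + c) • K m) ∧
      ∀ k, ∃ L : ℕ → H →L[ℂ] H, Monotone L ∧ (∀ N, L N ∈ M) ∧ (∀ N, 0 ≤ L N) ∧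
        (∀ N, L N ≤ ∑ m ∈ Finset.range N, a (m + k)) ∧
        ∀ v, Tendsto (fun N => L N v) atTop (𝓝 (K k v)) := by
  -- The tails of the series may be unbounded, so S is replaced by 1 - (1 + S)⁻¹, which lies in [0,
  -- 1], is monotone in S and is at most S. Its limit as N → ∞ is K k.
  set S : ℕ → ℕ → H →L[ℂ] H := fun k N => ∑ m ∈ Finset.Ico k N, a m with hS
  have hS0 : ∀ k N, 0 ≤ S k N := fun k N => Finset.sum_nonneg fun m _ => h0 m
  have hSM : ∀ k N, S k N ∈ M := fun k N => sum_mem fun m _ => haM m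
  have hSmono : ∀ k, Monotone (S k) := fun k N N' h =>
    Finset.sum_le_sum_of_subset_of_nonneg (Finset.Ico_subset_Ico_right h) fun m _ _ => h0 m
  have hSanti : ∀ N, Antitone fun k => S k N := fun N k k' h =>
    Finset.sum_le_sum_of_subset_of_nonneg (Finset.Ico_subset_Ico_left h) fun m _ _ => h0 m
  have hR : ∀ k, ∃ R : H →L[ℂ] H, ∀ v, Tendsto (fun N => res (S k N) v) atTop (𝓝 (R v)) :=
    fun k => exists_tendsto_of_antitone (fun N N' h => res_antitone (hS0 k N) (hSmono k h))
      fun N => res_nonneg (hS0 k N)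
  choose R hR using hR
  have hK : ∀ k v, Tendsto (fun N => (1 - res (S k N)) v) atTop (𝓝 ((1 - R k) v)) := fun k v =>
    tendsto_const_nhds.sub (hR k v)
  have hconst : ∀ (x : H →L[ℂ] H) v, Tendsto (fun _ : ℕ => x v) atTop (𝓝 (x v)) :=
    fun _ _ => tendsto_const_nhds
  have hKanti : Antitone fun k => 1 - R k := fun k k' h =>
    le_of_tendsto_of_le (hK k') (hK k) (Eventually.of_forall fun N =>
      sub_le_sub_left (res_antitone (hS0 k' N) (hSanti N h)) 1)
  have hK0 : ∀ k, 0 ≤ 1 - R k := fun k => le_of_tendsto_of_le (hconst 0) (hK k)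
    (Eventually.of_forall fun N => one_sub_res_nonneg (hS0 k N))
  have hKM : ∀ k, 1 - R k ∈ M := fun k =>
    mem_of_tendsto_apply (fun N => sub_mem (one_mem M) (res_mem (hS0 k N) (hSM k N))) (hK k)
  obtain ⟨K', hK'⟩ := exists_tendsto_of_antitone hKanti hK0
  refine ⟨fun k => 1 - R k, K', hKanti, hKM, hK0,
    fun k => le_of_tendsto_of_le (hK k) (hconst 1)
      (Eventually.of_forall fun N => one_sub_res_le_one (hS0 k N)),
    le_of_tendsto_of_le (hconst 0) hK' (Eventually.of_forall hK0), mem_of_tendsto_apply hKM hK',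
    fun k => le_of_tendsto_of_le hK' (hconst _) (eventually_atTop.2 ⟨k, fun m hm => hKanti hm⟩),
    hK', fun m => ?_, fun k => ⟨fun N => 1 - res (S k (k + N)), fun N N' h =>
      sub_le_sub_left (res_antitone (hS0 k _) (hSmono k (by gcongr))) 1, fun N =>
      sub_mem (one_mem M) (res_mem (hS0 k _) (hSM k _)), fun N => one_sub_res_nonneg (hS0 k _),
      fun N => ?_, fun v => ?_⟩⟩
  · refine le_of_tendsto_of_le (l := atTop) (a := fun _ : ℕ => a m)
      (b := fun N => (1 + c) • (1 - res (S m N))) (hconst _)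
      (fun v => (hK m v).const_smul (1 + c)) (eventually_atTop.2 ⟨m + 1, fun N hN => ?_⟩)
    have h1 : a m ≤ S m N :=
      Finset.single_le_sum (fun i _ => h0 i) (Finset.mem_Ico.2 ⟨le_rfl, hN⟩)
    refine (le_smul_one_sub_res (h0 m) (hc m)).trans ?_
    exact smul_le_smul_of_nonneg_left (sub_le_sub_left (res_antitone (h0 m) h1) 1) (by linarith)
  · refine (one_sub_res_le (hS0 k _)).trans (le_of_eq ?_)
    simp only [hS]
    rw [Finset.sum_Ico_eq_sum_range]
    simp [add_comm]
  · exact (hK k v).comp (tendsto_atTop_mono (fun N => Nat.le_add_left N k) tendsto_id)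

/-- On a projection of finite trace, summability of the matrix coefficients of a bounded positive
sequence at a dense family of vectors implies convergence to zero in trace. -/
theorem tendsto_trace_zero_of_summable_inner {y : ℕ → H →L[ℂ] H} {P : H →L[ℂ] H}
    (hP : P ∈ finProj ρ) (hyM : ∀ m, y m ∈ M) (h0 : ∀ m, 0 ≤ y m) (h1 : ∀ m, y m ≤ 1)
    (hyP : ∀ m, P * y m * P = y m) {ι : Type*} {ξ : ι → H} (hξ : DenseRange ξ)
    (hsum : ∀ i, Summable fun m => (⟪ξ i, y m (ξ i)⟫_ℂ).re) :
    Tendsto (fun m => ρ (y m)) atTop (𝓝 0) := by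
  obtain ⟨K, K', hKanti, hKM, hK0, hK1, hK'0, -, hK'le, hK', hyK, hL⟩ :=
    exists_antitone_dominating (c := 1) hyM h0 zero_le_one (by simpa using h1)
  -- The form of K' at ξ i is bounded by every tail of a convergent series, and a positive operator
  -- kills a vector where its form vanishes.
  have hKξ : ∀ i, K' (ξ i) = 0 := by
    intro i
    apply apply_eq_zero_of_inner_eq_zero hK'0
    refine ge_of_tendsto' (tendsto_sum_nat_add fun m => (⟪ξ i, y m (ξ i)⟫_ℂ).re) fun k => ?_
    refine (re_inner_mono (hK'le k) _).trans ?_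
    obtain ⟨L, -, -, -, hLle, hLt⟩ := hL k
    have ht : Tendsto (fun N => (⟪ξ i, L N (ξ i)⟫_ℂ).re) atTop (𝓝 (⟪ξ i, K k (ξ i)⟫_ℂ).re) :=
      (Complex.continuous_re.tendsto _).comp (tendsto_const_nhds.inner (hLt (ξ i)))
    refine le_of_tendsto' ht fun N => ?_
    refine (re_inner_mono (hLle N) _).trans ?_
    have e : (⟪ξ i, (∑ m ∈ Finset.range N, y (m + k)) (ξ i)⟫_ℂ).re
        = ∑ m ∈ Finset.range N, (⟪ξ i, y (m + k) (ξ i)⟫_ℂ).re := by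
      rw [sum_apply, inner_sum, Complex.re_sum]
    rw [e]
    exact ((summable_nat_add_iff k).2 (hsum i)).sum_le_tsum _ fun m _ => re_inner_nonneg (h0 _) _
  have hK'z : ∀ v, K' v = 0 := fun v => congrFun (hξ.equalizer K'.continuous
    (continuous_const (y := (0 : H))) (funext hKξ)) v
  have hPKM : ∀ m, P * K m * P ∈ M := fun m => mul_mem (mul_mem hP.1.1 (hKM m)) hP.1.1
  have hPK0 : ∀ m, 0 ≤ P * K m * P := fun m => hP.1.2.isSelfAdjoint.conjugate_nonneg (hK0 m)
  have hPKP : ∀ m, P * K m * P ≤ P := fun m => by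
    simpa [hP.1.2.isIdempotentElem.eq] using proj_conjugate_mono hP.1.2 (hK1 m)
  -- Normality concerns increasing families, so it is applied to P - P K m P ↑ P; finiteness of ρ P
  -- then allows subtraction.
  have hsup : ρ P = ⨆ m, ρ (P - P * K m * P) := by
    refine trace_eq_iSup_of_tendsto ρ
      (fun m m' h => sub_le_sub_left (proj_conjugate_mono hP.1.2 (hKanti h)) P)
      (fun m => sub_mem hP.1.1 (hPKM m)) (fun m => sub_nonneg.2 (hPKP m)) fun v => ?_
    have h2 : Tendsto (fun m => P (K m (P v))) atTop (𝓝 (P 0)) := by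
      have := hK' (P v)
      rw [hK'z] at this
      exact (P.continuous.tendsto 0).comp this
    have h3 := (tendsto_const_nhds (x := P v)).sub h2
    rw [map_zero, sub_zero] at h3
    exact h3
  have hmono : Monotone fun m => ρ (P - P * K m * P) := fun m m' h =>
    trace_mono ρ (sub_mem hP.1.1 (hPKM m)) (sub_mem hP.1.1 (hPKM m')) (sub_nonneg.2 (hPKP m))
      (sub_le_sub_left (proj_conjugate_mono hP.1.2 (hKanti h)) P)
  have hlim : Tendsto (fun m => ρ (P - P * K m * P)) atTop (𝓝 (ρ P)) := by
    rw [hsup]; exact tendsto_atTop_iSup hmono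
  have hPK : ∀ m, ρ (P * K m * P) = ρ P - ρ (P - P * K m * P) := by
    intro m
    have h2 := ρ.map_add' _ (hPKM m) _ (sub_mem hP.1.1 (hPKM m)) (hPK0 m) (sub_nonneg.2 (hPKP m))
    rw [add_sub_cancel] at h2
    have h3 : ρ (P - P * K m * P) ≠ ∞ := by
      refine ((?_ : ρ (P - P * K m * P) ≤ ρ P).trans_lt hP.2).ne
      rw [h2]; exact le_add_self
    rw [h2, ENNReal.add_sub_cancel_right h3]
  have hPKt : Tendsto (fun m => ρ (P * K m * P)) atTop (𝓝 0) := by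
    have := ENNReal.Tendsto.sub (tendsto_const_nhds (x := ρ P)) hlim (Or.inl hP.2.ne)
    rw [tsub_self] at this
    exact this.congr fun m => (hPK m).symm
  have h2 : Tendsto (fun m => ENNReal.ofReal (1 + 1) * ρ (P * K m * P)) atTop (𝓝 0) := by
    simpa using ENNReal.Tendsto.const_mul hPKt (Or.inr (ENNReal.ofReal_ne_top (r := 1 + 1)))
  refine tendsto_of_tendsto_of_tendsto_of_le_of_le tendsto_const_nhds h2 (fun m => zero_le)
    fun m => ?_
  rw [← trace_smul ρ (by norm_num) (hPKM m) (hPK0 m)]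
  refine trace_mono ρ (hyM m) (real_smul_mem_vN _ (hPKM m)) (h0 m) ?_
  have h3 := proj_conjugate_mono hP.1.2 (hyK m)
  rwa [hyP, mul_smul_comm, smul_mul_assoc] at h3

/-- A bounded positive sequence with summable traces converges strongly to zero. -/
theorem tendsto_apply_zero_of_tsum_trace {a : ℕ → H →L[ℂ] H} {c : ℝ} (haM : ∀ m, a m ∈ M)
    (h0 : ∀ m, 0 ≤ a m) (hc0 : 0 ≤ c) (hc : ∀ m, a m ≤ c • (1 : H →L[ℂ] H))
    (hsum : ∑' m, ρ (a m) ≠ ∞) (v : H) : Tendsto (fun m => a m v) atTop (𝓝 0) := by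
  obtain ⟨K, K', hKanti, hKM, hK0, hK1, hK'0, hK'M, hK'le, hK', haK, hL⟩ :=
    exists_antitone_dominating haM h0 hc0 hc
  -- The trace of K' is bounded by every tail of the convergent series of traces, so faithfulness
  -- applies.
  have hK'z : K' = 0 := by
    refine ρ.faithful' K' hK'M hK'0 (le_antisymm ?_ (zero_le))
    refine ge_of_tendsto' (ENNReal.tendsto_sum_nat_add (fun m => ρ (a m)) hsum) fun k => ?_
    refine (trace_mono ρ hK'M (hKM k) hK'0 (hK'le k)).trans ?_
    obtain ⟨L, hLm, hLM, hL0, hLle, hLt⟩ := hL k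
    rw [trace_eq_iSup_of_tendsto ρ hLm hLM hL0 hLt]
    refine iSup_le fun N => ?_
    refine (trace_mono ρ (hLM N) (sum_mem fun m _ => haM _) (hL0 N) (hLle N)).trans ?_
    rw [trace_sum ρ _ (fun m => haM (m + k)) (fun m => h0 (m + k))]
    exact ENNReal.sum_le_tsum _
  have h1 : Tendsto (fun m => c * ((1 + c) * (⟪v, K m v⟫_ℂ).re)) atTop (𝓝 0) := by
    have h2 : Tendsto (fun m => (⟪v, K m v⟫_ℂ).re) atTop (𝓝 (⟪v, K' v⟫_ℂ).re) :=
      (Complex.continuous_re.tendsto _).comp (tendsto_const_nhds.inner (hK' v))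
    rw [hK'z] at h2
    simpa using (h2.const_mul (1 + c)).const_mul c
  have h2 : Tendsto (fun m => ‖a m v‖ ^ 2) atTop (𝓝 0) := by
    refine squeeze_zero (fun m => sq_nonneg _) (fun m => ?_) h1
    refine (norm_apply_sq_le (h0 m) (hc m) v).trans (mul_le_mul_of_nonneg_left ?_ hc0)
    refine (re_inner_mono (haK m) v).trans (le_of_eq ?_)
    rw [smul_apply, ← Complex.coe_smul, inner_smul_right,
      Complex.re_ofReal_mul]
  rw [tendsto_zero_iff_norm_tendsto_zero]
  have h3 := h2.sqrt
  simpa using h3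

end Domination

/-! ### The symmetric norm: ideal property and smallness criteria. -/

section SymmNorm

variable (J : SymmNorm ρ)

theorem singularValue_set_nonempty (t : ℝ) (x : H →L[ℂ] H) :
    {r | ∃ P ∈ finProj ρ, ρ P ≤ ENNReal.ofReal t ∧ r = ‖x * (1 - P)‖}.Nonempty :=
  ⟨_, 0, ⟨⟨zero_mem M, IsStarProjection.zero _⟩, by simp [trace_zero]⟩, by simp [trace_zero], rfl⟩

theorem singularValue_le {t : ℝ} {x P : H →L[ℂ] H} (hP : P ∈ finProj ρ)
    (ht : ρ P ≤ ENNReal.ofReal t) : singularValue ρ t x ≤ ‖x * (1 - P)‖ :=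
  csInf_le ⟨0, by rintro _ ⟨P, -, -, rfl⟩; exact norm_nonneg _⟩ ⟨P, hP, ht, rfl⟩

theorem SymmNorm.mul_left_le {x T : H →L[ℂ] H} (hT : T ∈ M) (hx : x ∈ finRank ρ) :
    J (T * x) ≤ ‖T‖ * J x := by
  have hx' := finRank_subset_L1 hx
  have e : J (((‖T‖ : ℝ) : ℂ) • x) = ‖T‖ * J x := by
    rw [J.smul' _ _ hx']; simp
  rw [← e]
  refine J.mono' _ (finRank_subset_L1 (finRank_mul_left hT hx)) _
    (finRank_subset_L1 (finRank_smul _ hx)) fun t _ => ?_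
  refine le_csInf (singularValue_set_nonempty t _) ?_
  rintro _ ⟨P, hP, hPt, rfl⟩
  refine (singularValue_le hP hPt).trans ?_
  rw [smul_mul_assoc, norm_smul, mul_assoc]
  simpa using norm_mul_le T (x * (1 - P))

/-- A projection P tested for x must be moved past T. The right support Q of PT has trace at most ρ
P, and PT(1 - Q) = 0 gives xT(1 - Q) = x(1 - P)T(1 - Q). -/
theorem SymmNorm.mul_right_le {x T : H →L[ℂ] H} (hT : T ∈ M) (hx : x ∈ finRank ρ) :
    J (x * T) ≤ ‖T‖ * J x := by
  have hx' := finRank_subset_L1 hx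
  have e : J (((‖T‖ : ℝ) : ℂ) • x) = ‖T‖ * J x := by
    rw [J.smul' _ _ hx']; simp
  rw [← e]
  refine J.mono' _ (finRank_subset_L1 (finRank_mul_right hT hx)) _
    (finRank_subset_L1 (finRank_smul _ hx)) fun t _ => ?_
  refine le_csInf (singularValue_set_nonempty t _) ?_
  rintro _ ⟨P, hP, hPt, rfl⟩
  obtain ⟨Q, hQ, hPQ, hQP⟩ := exists_right_proj ρ (mul_mem hP.1.1 hT) hP
    (by rw [← mul_assoc, hP.1.2.isIdempotentElem.eq])
  refine (singularValue_le hQ (hQP.trans hPt)).trans ?_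
  have e1 : x * T * (1 - Q) = (x * (1 - P)) * (T * (1 - Q)) := by
    have h2 : P * T * (1 - Q) = 0 := by rw [mul_sub, mul_one, hPQ, sub_self]
    have h3 : (x * (1 - P)) * (T * (1 - Q)) = x * T * (1 - Q) - x * (P * T * (1 - Q)) := by
      noncomm_ring
    rw [h3, h2, mul_zero, sub_zero]
  have h4 : ‖1 - Q‖ ≤ 1 := hQ.1.2.one_sub.norm_le
  rw [e1, smul_mul_assoc, norm_smul]
  calc ‖x * (1 - P) * (T * (1 - Q))‖ ≤ ‖x * (1 - P)‖ * (‖T‖ * ‖1 - Q‖) :=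
        (norm_mul_le _ _).trans (by gcongr; exact norm_mul_le _ _)
    _ ≤ ‖x * (1 - P)‖ * (‖T‖ * 1) := by gcongr
    _ = ‖((‖T‖ : ℝ) : ℂ)‖ * ‖x * (1 - P)‖ := by simp [mul_comm]

theorem SymmNorm.sub_le {x y : H →L[ℂ] H} (hx : x ∈ finRank ρ) (hy : y ∈ finRank ρ) :
    J (x - y) ≤ J x + J y := by
  have h := J.add_le' x (finRank_subset_L1 hx) _ (finRank_subset_L1 (finRank_smul (-1) hy))
  rw [J.smul' _ _ (finRank_subset_L1 hy)] at h
  simpa [sub_eq_add_neg] using h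

theorem SymmNorm.add_le {x y : H →L[ℂ] H} (hx : x ∈ finRank ρ) (hy : y ∈ finRank ρ) :
    J (x + y) ≤ J x + J y :=
  J.add_le' x (finRank_subset_L1 hx) _ (finRank_subset_L1 hy)

theorem SymmNorm.commutator_le {x T : H →L[ℂ] H} (hT : T ∈ M) (hx : x ∈ finRank ρ) :
    J (T * x - x * T) ≤ 2 * ‖T‖ * J x := by
  have h1 := J.sub_le (finRank_mul_left hT hx) (finRank_mul_right hT hx)
  have h2 := J.mul_left_le hT hx
  have h3 := J.mul_right_le hT hx
  linarith

/-- `|·|_J` is small on operators with small norm and controlled support. -/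
theorem SymmNorm.exists_le_mul_trace_add_one : ∃ C : ℝ, 0 < C ∧ ∀ x P : H →L[ℂ] H, ∀ η : ℝ, P ∈ finProj ρ →
    x ∈ M → (x * P = x ∨ P * x = x) → ‖x‖ ≤ η → J x ≤ C * ((ρ P).toReal + 1) * η := by
  obtain ⟨C₁, C, -, hC, h⟩ := J.bounds'
  refine ⟨C, hC, fun x P η hP hx hxP hη => ?_⟩
  have hη0 := (norm_nonneg x).trans hη
  have h1 : ρ (CFC.abs x) ≤ ENNReal.ofReal η * ρ P :=
    hxP.elim (fun h => trace_abs_le hx hP.1 h hη) fun h => trace_abs_le' hx hP h hη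
  have h2 : x ∈ L1 ρ := ⟨hx, h1.trans_lt (ENNReal.mul_lt_top ENNReal.ofReal_lt_top hP.2)⟩
  have h3 : norm1 ρ x ≤ η * (ρ P).toReal := by
    have := ENNReal.toReal_mono (ENNReal.mul_lt_top ENNReal.ofReal_lt_top hP.2).ne h1
    rwa [ENNReal.toReal_mul, ENNReal.toReal_ofReal hη0] at this
  calc J x ≤ C * (norm1 ρ x + ‖x‖) := (h x h2).2
    _ ≤ C * (η * (ρ P).toReal + η) := by gcongr
    _ = C * ((ρ P).toReal + 1) * η := by ring

/-- Convergence to zero in trace of `x_k* x_k` below a fixed projection of finite trace implies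
convergence of `x_k` and `x_k*` to zero in `|·|_J`. -/
theorem SymmNorm.tendsto_zero_of_trace {x : ℕ → H →L[ℂ] H} {P : H →L[ℂ] H} (hP : P ∈ finProj ρ)
    (hxM : ∀ k, x k ∈ M) (hxP : ∀ k, x k * P = x k) (hx1 : ∀ k, ‖x k‖ ≤ 1)
    (ht : Tendsto (fun k => ρ (star (x k) * x k)) atTop (𝓝 0)) :
    Tendsto (fun k => J (x k)) atTop (𝓝 0) ∧ Tendsto (fun k => J (star (x k))) atTop (𝓝 0) := by
  obtain ⟨C, hC, hJ⟩ := J.exists_le_mul_trace_add_one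
  have hfin : ∀ k, x k ∈ finRank ρ := fun k => ⟨hxM k, P, hP, hxP k⟩
  -- Split x k at the spectral projection E k of x k* x k for (s², ∞). Chebyshev gives ρ(E k) → 0,
  -- so δ k = |E k|_J → 0 controls x k E k; the remainder has norm at most s and is carried by P.
  have key : ∀ s : ℝ, 0 < s → ∃ δ : ℕ → ℝ, Tendsto δ atTop (𝓝 0) ∧ ∀ᶠ k in atTop,
      J (x k) ≤ δ k + C * ((ρ P).toReal + 1) * s ∧
      J (star (x k)) ≤ δ k + C * ((ρ P).toReal + 1) * s := by
    intro s hs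
    have hspec := fun k => exists_spectral_proj ρ (mul_mem (star_mem (hxM k)) (hxM k))
      (star_mul_self_nonneg (x k)) (pow_pos hs 2)
    choose E hE hEt hEn hEc using hspec
    have hEle : ∀ k, ρ (E k) ≤ ρ (star (x k) * x k) / ENNReal.ofReal (s ^ 2) := fun k => by
      rw [ENNReal.le_div_iff_mul_le (Or.inl (by simpa using hs.ne'))
        (Or.inl ENNReal.ofReal_ne_top), mul_comm]
      exact hEt k
    have hEfin : ∀ k, E k ∈ finProj ρ := fun k => by
      refine ⟨hE k, (hEle k).trans_lt (ENNReal.div_lt_top ?_ (by simpa using hs.ne'))⟩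
      have h1 : star (x k) * x k ≤ (1 : ℝ) • P := by
        refine le_smul_proj hP.1.2 (star_mul_self_nonneg _) ?_ (by rw [mul_assoc, hxP])
        refine smul_le_smul_one_of_norm_le (star_mul_self_nonneg _) ?_
        rw [CStarRing.norm_star_mul_self]
        exact mul_le_one₀ (hx1 k) (norm_nonneg _) (hx1 k)
      rw [one_smul] at h1
      exact ((trace_mono ρ (mul_mem (star_mem (hxM k)) (hxM k)) hP.1.1
        (star_mul_self_nonneg _) h1).trans_lt hP.2).ne
    have hE0 : Tendsto (fun k => ρ (E k)) atTop (𝓝 0) := by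
      have h1 : Tendsto (fun k => ρ (star (x k) * x k) / ENNReal.ofReal (s ^ 2)) atTop (𝓝 0) := by
        have := ENNReal.Tendsto.div_const ht (b := ENNReal.ofReal (s ^ 2))
          (Or.inr (by simpa using hs.ne'))
        simpa using this
      exact tendsto_of_tendsto_of_tendsto_of_le_of_le tendsto_const_nhds h1
        (fun _ => zero_le) hEle
    refine ⟨fun k => J (E k), J.tendsto_zero' E hEfin hE0, Eventually.of_forall fun k => ?_⟩
    have hEs := (hE k).2.isSelfAdjoint.star_eq
    have hcommP : Commute P (star (x k) * x k) := by
      have h1 : P * star (x k) = star (x k) := by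
        have := congrArg star (hxP k)
        rwa [star_mul, hP.1.2.isSelfAdjoint.star_eq] at this
      change P * (star (x k) * x k) = star (x k) * x k * P
      rw [mul_assoc, hxP, ← mul_assoc, h1]
    -- Commutation with P keeps the remainder x k (1 - E k) carried by P, so that its norm bound
    -- turns into a bound in J.
    have hPE := (hEc k P hcommP).eq
    have hn : ‖x k * (1 - E k)‖ ≤ s := by
      have h1 : ‖x k * (1 - E k)‖ ^ 2 ≤ s ^ 2 := by
        rw [sq, ← CStarRing.norm_star_mul_self, star_mul, star_sub, star_one, hEs]
        have e : (1 - E k) * star (x k) * (x k * (1 - E k))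
            = (1 - E k) * (star (x k) * x k) * (1 - E k) := by simp only [mul_assoc]
        rw [e]
        refine norm_le_of_le_smul_one (by positivity) ?_ (hEn k)
        exact (hE k).2.one_sub.isSelfAdjoint.conjugate_nonneg (star_mul_self_nonneg _)
      exact le_of_sq_le_sq h1 hs.le
    have hyM : x k * (1 - E k) ∈ M := mul_mem (hxM k) (sub_mem (one_mem M) (hE k).1)
    have hyP : x k * (1 - E k) * P = x k * (1 - E k) := by
      rw [mul_assoc, sub_mul, one_mul, ← hPE, mul_sub, ← mul_assoc, hxP, mul_sub, mul_one]
    have hyfin : x k * (1 - E k) ∈ finRank ρ := ⟨hyM, P, hP, hyP⟩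
    have hE' := finProj_subset_finRank (hEfin k)
    have hnn : 0 ≤ J (E k) := J.nonneg' _ (finRank_subset_L1 hE')
    constructor
    · have e : x k = x k * E k + x k * (1 - E k) := by noncomm_ring
      have h1 := J.add_le (finRank_mul_left (hxM k) hE') hyfin
      rw [← e] at h1
      have h2 := J.mul_left_le (hxM k) hE'
      have h3 := hJ _ P s hP hyM (Or.inl hyP) hn
      nlinarith [hx1 k]
    · have e : star (x k) = E k * star (x k) + star (x k * (1 - E k)) := by
        rw [star_mul, star_sub, star_one, hEs]; noncomm_ring
      have h1 := J.add_le (finRank_mul_right (star_mem (hxM k)) hE') (finRank_star hyfin)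
      rw [← e] at h1
      have h2 := J.mul_right_le (star_mem (hxM k)) hE'
      rw [norm_star] at h2
      have h3 := hJ _ P s hP (star_mem hyM) (Or.inr (by
        have := congrArg star hyP
        rwa [star_mul, hP.1.2.isSelfAdjoint.star_eq] at this)) (by rwa [norm_star])
      nlinarith [hx1 k]
  have hCP : 0 < C * ((ρ P).toReal + 1) := by positivity
  have fin : ∀ ε : ℝ, 0 < ε → ∀ᶠ k in atTop, J (x k) < ε ∧ J (star (x k)) < ε := by
    intro ε hε
    obtain ⟨δ, hδ, hk⟩ := key (ε / 2 / (C * ((ρ P).toReal + 1))) (by positivity)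
    filter_upwards [hk, hδ.eventually (gt_mem_nhds (half_pos hε))] with k h1 h2
    rw [mul_div_cancel₀ _ hCP.ne'] at h1
    constructor <;> linarith
  constructor
  · refine tendsto_order.2 ⟨fun c hc => ?_, fun c hc => (fin c hc).mono fun k hk => hk.1⟩
    exact Eventually.of_forall fun k =>
      hc.trans_le (J.nonneg' _ (finRank_subset_L1 (hfin k)))
  · refine tendsto_order.2 ⟨fun c hc => ?_, fun c hc => (fin c hc).mono fun k hk => hk.2⟩
    exact Eventually.of_forall fun k =>
      hc.trans_le (J.nonneg' _ (finRank_subset_L1 (finRank_star (hfin k))))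

end SymmNorm

end QuasicentralModulus

/-! ### Weak operator limits: Mazur's theorem and vanishing of limits. -/

namespace QuasicentralModulus

variable {H : Type*} [NormedAddCommGroup H] [InnerProductSpace ℂ H]

/-- Mazur's theorem for the weak operator topology and finitely many vectors. -/
theorem exists_mem_convex_norm_sub_lt {S : Set (H →L[ℂ] H)} (hS : Convex ℝ S)
    {B : ℕ → H →L[ℂ] H} {B' : H →L[ℂ] H} (hB : ∀ᶠ m in atTop, B m ∈ S)
    (h : ∀ v (f : StrongDual ℂ H), Tendsto (fun m => f (B m v)) atTop (𝓝 (f (B' v))))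
    {N : ℕ} (ζ : Fin N → H) {η : ℝ} (hη : 0 < η) : ∃ C ∈ S, ∀ i, ‖C (ζ i) - B' (ζ i)‖ < η := by
  let Φ : (H →L[ℂ] H) →ₗ[ℝ] (Fin N → H) :=
    { toFun := fun C i => C (ζ i)
      map_add' := fun _ _ => rfl
      map_smul' := fun _ _ => rfl }
  have hmem : Φ B' ∈ closure (Φ '' S) := by
    by_contra hn
    -- A separating functional on the product splits into functionals of single coordinates, along
    -- which B m converges; this contradicts strict separation.
    obtain ⟨f, u, hu, hfu⟩ := RCLike.geometric_hahn_banach_point_closed (𝕜 := ℂ)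
      (hS.linear_image Φ).closure isClosed_closure hn
    have hf : ∀ C, f (Φ C) = ∑ i, (f.comp (ContinuousLinearMap.single ℂ (fun _ => H) i))
        (C (ζ i)) := by
      intro C
      conv_lhs => rw [← Finset.univ_sum_single (Φ C)]
      rw [map_sum]
      rfl
    have ht : Tendsto (fun m => f (Φ (B m))) atTop (𝓝 (f (Φ B'))) := by
      simp only [hf]
      exact tendsto_finsetSum _ fun i _ => h _ _
    have ht' := (Complex.continuous_re.tendsto _).comp ht
    have : u ≤ (f (Φ B')).re := by
      refine ge_of_tendsto ht' ?_
      filter_upwards [hB] with m hm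
      exact (hfu _ (subset_closure ⟨_, hm, rfl⟩)).le
    exact absurd hu (not_lt.2 this)
  obtain ⟨_, ⟨C, hC, rfl⟩, hd⟩ := Metric.mem_closure_iff.1 hmem η hη
  refine ⟨C, hC, fun i => ?_⟩
  rw [dist_comm, dist_eq_norm] at hd
  exact (norm_le_pi_norm (Φ C - Φ B') i).trans_lt hd

variable [CompleteSpace H] {M : VonNeumannAlgebra H} {ρ : Trace M}

section WeakLimits

theorem exists_norm_le_of_tendsto_inner {B : ℕ → H →L[ℂ] H} {B' : H →L[ℂ] H}
    (h : ∀ v w, Tendsto (fun m => ⟪w, B m v⟫_ℂ) atTop (𝓝 ⟪w, B' v⟫_ℂ)) :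
    ∃ C, ∀ m, ‖B m‖ ≤ C := by
  refine banach_steinhaus fun v => ?_
  obtain ⟨C, hC⟩ := banach_steinhaus (g := fun m => innerSL ℂ (B m v)) fun w => by
    obtain ⟨C, hC⟩ := (h v w).norm.bddAbove_range
    refine ⟨C, fun m => ?_⟩
    rw [innerSL_apply_apply, norm_inner_symm]
    exact hC ⟨m, rfl⟩
  exact ⟨C, fun m => by simpa using hC m⟩

theorem norm_abs_apply (x : H →L[ℂ] H) (v : H) : ‖CFC.abs x v‖ = ‖x v‖ := by
  have key : ∀ y : H →L[ℂ] H, ‖y v‖ ^ 2 = (⟪v, (star y * y) v⟫_ℂ).re := by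
    intro y
    have : ⟪v, (star y * y) v⟫_ℂ = ⟪y v, y v⟫_ℂ := ContinuousLinearMap.adjoint_inner_right y v (y v)
    rw [this, inner_self_eq_norm_sq_to_K]
    norm_cast
  have h : ‖CFC.abs x v‖ ^ 2 = ‖x v‖ ^ 2 := by
    rw [key, key, (CFC.abs_nonneg x).isSelfAdjoint.star_eq, CFC.abs_mul_abs]
  exact (sq_eq_sq₀ (norm_nonneg _) (norm_nonneg _)).1 h

/-- A weak limit of elements of finite trace-rank that converge to zero in `|·|_J` vanishes. -/
theorem SymmNorm.eq_zero_of_tendsto (J : SymmNorm ρ) {x : ℕ → H →L[ℂ] H} {x' : H →L[ℂ] H}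
    (hx : ∀ m, x m ∈ finRank ρ)
    (hlim : ∀ v w, Tendsto (fun m => ⟪w, x m v⟫_ℂ) atTop (𝓝 ⟪w, x' v⟫_ℂ))
    (hJ : Tendsto (fun m => J (x m)) atTop (𝓝 0)) : x' = 0 := by
  obtain ⟨c, hc⟩ := exists_norm_le_of_tendsto_inner hlim
  have hc0 : 0 ≤ c := (norm_nonneg _).trans (hc 0)
  obtain ⟨C₁, C₂, hC₁, -, hb⟩ := J.bounds'
  have hmin : Tendsto (fun m => min (norm1 ρ (x m)) ‖x m‖) atTop (𝓝 0) := by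
    refine squeeze_zero (g := fun m => J (x m) / C₁)
      (fun m => le_min ENNReal.toReal_nonneg (norm_nonneg _)) (fun m => ?_)
      (by simpa using hJ.div_const C₁)
    rw [le_div_iff₀ hC₁, mul_comm]
    exact (hb _ (finRank_subset_L1 (hx m))).1
  obtain ⟨φ, hφ, hφm⟩ := extraction_forall_of_eventually fun k : ℕ =>
    hmin.eventually (gt_mem_nhds (show (0 : ℝ) < (1 / 2) ^ k by positivity))
  classical
  -- For each k either the trace norm or the operator norm is below 2⁻ᵏ. Only terms of the first
  -- kind are kept, making the traces summable; the others tend to zero in norm.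
  set a : ℕ → H →L[ℂ] H := fun k =>
    if norm1 ρ (x (φ k)) < (1 / 2) ^ k then CFC.abs (x (φ k)) else 0 with ha
  have haM : ∀ k, a k ∈ M := fun k => by
    simp only [ha]; split_ifs
    exacts [abs_mem (hx _).1, zero_mem M]
  have ha0 : ∀ k, 0 ≤ a k := fun k => by
    simp only [ha]; split_ifs
    exacts [CFC.abs_nonneg _, le_rfl]
  have hac : ∀ k, a k ≤ c • (1 : H →L[ℂ] H) := fun k => by
    refine smul_le_smul_one_of_norm_le (ha0 k) ?_
    simp only [ha]; split_ifs
    · rw [CFC.norm_abs]; exact hc _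
    · simpa using hc0
  have hat : ∀ k, ρ (a k) ≤ ENNReal.ofReal ((1 / 2) ^ k) := fun k => by
    simp only [ha]; split_ifs with h
    · rw [← ENNReal.ofReal_toReal (finRank_subset_L1 (hx (φ k))).2.ne]
      exact ENNReal.ofReal_le_ofReal h.le
    · rw [trace_zero]; exact zero_le
  have hsum : ∑' k, ρ (a k) ≠ ∞ :=
    ne_top_of_le_ne_top summable_geometric_two.tsum_ofReal_ne_top (ENNReal.tsum_le_tsum hat)
  have hx0 : ∀ v, Tendsto (fun k => x (φ k) v) atTop (𝓝 0) := by
    intro v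
    have h1 := (tendsto_apply_zero_of_tsum_trace haM ha0 hc0 hac hsum v).norm
    have h2 : Tendsto (fun k : ℕ => (1 / 2 : ℝ) ^ k * ‖v‖) atTop (𝓝 0) := by
      simpa using (tendsto_pow_atTop_nhds_zero_of_lt_one (r := (1 / 2 : ℝ)) (by norm_num)
        (by norm_num)).mul_const ‖v‖
    refine squeeze_zero_norm (a := fun k => ‖a k v‖ + (1 / 2 : ℝ) ^ k * ‖v‖) (fun k => ?_)
      (by simpa using h1.add h2)
    rcases lt_or_ge (norm1 ρ (x (φ k))) ((1 / 2) ^ k) with h | h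
    · have : a k = CFC.abs (x (φ k)) := by simp only [ha]; rw [if_pos h]
      rw [this, norm_abs_apply]
      exact le_add_of_nonneg_right (by positivity)
    · have h3 : ‖x (φ k)‖ < (1 / 2) ^ k := (min_lt_iff.1 (hφm k)).resolve_left (not_lt.2 h)
      exact (((x (φ k)).le_opNorm v).trans (mul_le_mul_of_nonneg_right h3.le (norm_nonneg v))).trans
        (le_add_of_nonneg_left (norm_nonneg _))
  ext v
  refine ext_inner_left ℂ fun w => tendsto_nhds_unique ((hlim v w).comp hφ.tendsto_atTop) ?_
  exact tendsto_const_nhds.inner (hx0 v)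

end WeakLimits

/-! ### Construction of the approximate and exact units. -/

section Approximation

variable (J : SymmNorm ρ) {n : ℕ} {T : Fin n → H →L[ℂ] H}

/-- The convex set for Mazur's theorem: convex combinations keep all the properties of the B_m that
are needed. -/
theorem convex_commutator_le (hT : ∀ j, T j ∈ M) (ε : ℝ) :
    Convex ℝ {C : H →L[ℂ] H | C ∈ finRank ρ ∧ 0 ≤ C ∧ ∀ j, J (T j * C - C * T j) ≤ ε} := by
  rintro C ⟨hC, hC0, hCJ⟩ D ⟨hD, hD0, hDJ⟩ a b ha hb hab
  have hsm : ∀ (r : ℝ) {x : H →L[ℂ] H}, x ∈ finRank ρ → r • x ∈ finRank ρ := fun r _ hx =>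
    finRank_smul (r : ℂ) hx
  refine ⟨finRank_add (hsm a hC) (hsm b hD), add_nonneg (smul_nonneg ha hC0) (smul_nonneg hb hD0),
    fun j => ?_⟩
  have hC' := finRank_commutator (hT j) hC
  have hD' := finRank_commutator (hT j) hD
  have e : T j * (a • C + b • D) - (a • C + b • D) * T j
      = (a : ℂ) • (T j * C - C * T j) + (b : ℂ) • (T j * D - D * T j) := by
    simp only [Complex.coe_smul, mul_add, add_mul, smul_sub, mul_smul_comm, smul_mul_assoc]
    abel
  rw [e]
  refine (J.add_le (finRank_smul _ hC') (finRank_smul _ hD')).trans ?_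
  rw [J.smul' _ _ (finRank_subset_L1 hC'), J.smul' _ _ (finRank_subset_L1 hD'), Complex.norm_real,
    Complex.norm_real, Real.norm_of_nonneg ha, Real.norm_of_nonneg hb]
  calc a * J (T j * C - C * T j) + b * J (T j * D - D * T j) ≤ a * ε + b * ε := by
        gcongr
        exacts [hCJ j, hDJ j]
    _ = ε := by rw [← add_mul, hab, one_mul]

theorem commutator_one_sub_res {b x : H →L[ℂ] H} (hb : 0 ≤ b) :
    x * (1 - res b) - (1 - res b) * x = res b * ((x * b - b * x) * res b) := by
  calc x * (1 - res b) - (1 - res b) * x = res b * x - x * res b := by noncomm_ring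
    _ = res b * x * ((1 + b) * res b) - (res b * (1 + b)) * x * res b := by
        rw [mul_res hb, res_mul hb, mul_one, one_mul]
    _ = res b * ((x * b - b * x) * res b) := by noncomm_ring

theorem res_sub_res {b c : H →L[ℂ] H} (hb : 0 ≤ b) (hc : 0 ≤ c) :
    res c - res b = res c * (b - c) * res b := by
  calc res c - res b = res c * ((1 + b) * res b) - (res c * (1 + c)) * res b := by
        rw [mul_res hb, res_mul hc, mul_one, one_mul]
    _ = res c * (b - c) * res b := by noncomm_ring

theorem exists_finRankPosContr_approx (hT : ∀ j, T j ∈ M) {B : ℕ → H →L[ℂ] H} {B' : H →L[ℂ] H}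
    (hB : ∀ m, B m ∈ finRank ρ) (hB0 : ∀ m, 0 ≤ B m) (hB'0 : 0 ≤ B')
    (hlim : ∀ v (f : StrongDual ℂ H), Tendsto (fun m => f (B m v)) atTop (𝓝 (f (B' v))))
    (hJ : ∀ j, Tendsto (fun m => J (T j * B m - B m * T j)) atTop (𝓝 0))
    {N : ℕ} (ξ : Fin N → H) (hξ : ∀ i, supportProj B' (ξ i) = ξ i) {ε : ℝ} (hε : 0 < ε) :
    ∃ A ∈ finRankPosContr ρ, (∀ j, J (T j * A - A * T j) ≤ ε) ∧
      ∀ i, (⟪ξ i, (1 - A) (ξ i)⟫_ℂ).re ≤ ε := by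
  obtain ⟨s, hk, hs0⟩ : ∃ s : ℝ, (∀ i, ‖ξ i‖ * ‖res (s • B') (ξ i)‖ < ε / 2) ∧ 0 < s := by
    have h1 : ∀ i, ∀ᶠ k : ℕ in atTop, ‖ξ i‖ * ‖res ((k : ℝ) • B') (ξ i)‖ < ε / 2 := fun i => by
      have := ((tendsto_res_smul hB'0 (ξ i)).norm).const_mul ‖ξ i‖
      rw [hξ, sub_self, norm_zero, mul_zero] at this
      exact this.eventually (gt_mem_nhds (half_pos hε))
    obtain ⟨k, hk, hk0⟩ := ((eventually_all.2 h1).and (eventually_gt_atTop 0)).exists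
    exact ⟨k, hk, Nat.cast_pos.2 hk0⟩
  have hsB' : 0 ≤ s • B' := smul_nonneg hs0.le hB'0
  -- The scale s is fixed before C. The bound ε / s absorbs the factor s in [T, sC], and C need only
  -- be close to B' at the vectors (1 + sB')⁻¹ ξ i, where the second resolvent identity evaluates C
  -- - B'. The tolerance makes ‖ξ i‖ times the resolvent error at most ε / 2.
  obtain ⟨C, ⟨hC, hC0, hCJ⟩, hCζ⟩ := exists_mem_convex_norm_sub_lt
    (convex_commutator_le J hT (ε / s)) (B := B) (B' := B')
    (by
      have h1 : ∀ᶠ m in atTop, ∀ j, J (T j * B m - B m * T j) < ε / s :=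
        eventually_all.2 fun j => (hJ j).eventually (gt_mem_nhds (by positivity))
      filter_upwards [h1] with m hm using ⟨hB m, hB0 m, fun j => (hm j).le⟩)
    hlim (fun i => res (s • B') (ξ i)) (η := ε / 2 / (s * (1 + ∑ i, ‖ξ i‖))) (by positivity)
  have hsC : 0 ≤ s • C := smul_nonneg hs0.le hC0
  have hsCM : res (s • C) ∈ M := res_mem hsC (real_smul_mem_vN s hC.1)
  refine ⟨1 - res (s • C), ⟨?_, one_sub_res_nonneg hsC, one_sub_res_le_one hsC⟩,
    fun j => ?_, fun i => ?_⟩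
  · rw [one_sub_res hsC]
    exact finRank_mul_left hsCM (finRank_smul (s : ℂ) hC)
  · rw [commutator_one_sub_res hsC]
    have hfin := finRank_commutator (hT j) hC
    have hfin' : T j * s • C - s • C * T j ∈ finRank ρ :=
      finRank_commutator (hT j) (finRank_smul (s : ℂ) hC)
    have e : T j * s • C - s • C * T j = (s : ℂ) • (T j * C - C * T j) := by
      rw [mul_smul_comm, smul_mul_assoc, ← smul_sub, Complex.coe_smul]
    have hn := norm_res_le hsC
    have hnn : 0 ≤ J (T j * s • C - s • C * T j) := J.nonneg' _ (finRank_subset_L1 hfin')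
    have hnn' : 0 ≤ J ((T j * s • C - s • C * T j) * res (s • C)) :=
      J.nonneg' _ (finRank_subset_L1 (finRank_mul_right hsCM hfin'))
    calc J (res (s • C) * ((T j * s • C - s • C * T j) * res (s • C)))
        ≤ J ((T j * s • C - s • C * T j) * res (s • C)) :=
          (J.mul_left_le hsCM (finRank_mul_right hsCM hfin')).trans (mul_le_of_le_one_left hnn' hn)
      _ ≤ J (T j * s • C - s • C * T j) :=
          (J.mul_right_le hsCM hfin').trans (mul_le_of_le_one_left hnn hn)
      _ = s * J (T j * C - C * T j) := by
          rw [e, J.smul' _ _ (finRank_subset_L1 hfin), Complex.norm_real,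
            Real.norm_of_nonneg hs0.le]
      _ ≤ s * (ε / s) := by gcongr; exact hCJ j
      _ = ε := mul_div_cancel₀ _ hs0.ne'
  · rw [sub_sub_cancel]
    have hd : ‖(res (s • C) - res (s • B')) (ξ i)‖ ≤ s * ‖(C - B') (res (s • B') (ξ i))‖ := by
      rw [res_sub_res hsB' hsC]
      refine ((res (s • C)).le_opNorm _).trans
        ((mul_le_of_le_one_left (norm_nonneg _) (norm_res_le hsC)).trans (le_of_eq ?_))
      have : (s • B' - s • C) (res (s • B') (ξ i)) = -(s • (C - B') (res (s • B') (ξ i))) := by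
        simp [smul_sub]
      change ‖(s • B' - s • C) (res (s • B') (ξ i))‖ = _
      rw [this, norm_neg, norm_smul, Real.norm_of_nonneg hs0.le]
    have hsum : ‖ξ i‖ ≤ 1 + ∑ i, ‖ξ i‖ := by
      have := Finset.single_le_sum (f := fun i => ‖ξ i‖) (fun i _ => norm_nonneg _)
        (Finset.mem_univ i)
      linarith
    have hsum0 : 0 < 1 + ∑ i, ‖ξ i‖ := by positivity
    calc (⟪ξ i, res (s • C) (ξ i)⟫_ℂ).re ≤ ‖ξ i‖ * ‖res (s • C) (ξ i)‖ := re_inner_le_norm (𝕜 := ℂ) _ _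
      _ ≤ ‖ξ i‖ * (‖(res (s • C) - res (s • B')) (ξ i)‖ + ‖res (s • B') (ξ i)‖) := by
          gcongr
          calc ‖res (s • C) (ξ i)‖
              = ‖(res (s • C) - res (s • B')) (ξ i) + res (s • B') (ξ i)‖ := by simp
            _ ≤ _ := norm_add_le _ _
      _ ≤ (1 + ∑ i, ‖ξ i‖) * (s * (ε / 2 / (s * (1 + ∑ i, ‖ξ i‖)))) + ε / 2 := by
          rw [mul_add]
          refine add_le_add (mul_le_mul hsum (hd.trans ?_) (norm_nonneg _) hsum0.le) (hk i).le
          gcongr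
          exact (hCζ i).le
      _ = ε := by field_simp; ring

theorem exists_finRankPosContr_eq_one_on [TopologicalSpace.SeparableSpace H]
    (hT : ∀ j, T j ∈ M) {F P : H →L[ℂ] H} (hP : P ∈ finProj ρ) (hFP : F * P = P)
    (happ : ∀ (N : ℕ) (ξ : Fin N → H), (∀ i, F (ξ i) = ξ i) → ∀ ε : ℝ, 0 < ε →
      ∃ A ∈ finRankPosContr ρ, (∀ j, J (T j * A - A * T j) ≤ ε) ∧
        ∀ i, (⟪ξ i, (1 - A) (ξ i)⟫_ℂ).re ≤ ε) {ε : ℝ} (hε : 0 < ε) :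
    ∃ A ∈ finRankPosContr ρ, A * P = P ∧ ∀ j, J (T j * A - A * T j) ≤ ε := by
  have hPs := hP.1.2.isSelfAdjoint.star_eq
  have hPi := hP.1.2.isIdempotentElem.eq
  set u := TopologicalSpace.denseSeq H
  -- A k handles only the first k vectors P u i, with error 2⁻ᵏ; each fixed i is covered once k > i,
  -- which suffices for summability.
  have h := fun k : ℕ => happ k (fun i => P (u i)) (fun i => DFunLike.congr_fun hFP _)
    ((1 / 2) ^ k) (by positivity)
  choose A hA hAJ hAu using h
  have hAM : ∀ k, 1 - A k ∈ M := fun k => sub_mem (one_mem M) (hA k).1.1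
  have hA0 : ∀ k, 0 ≤ 1 - A k := fun k => sub_nonneg.2 (hA k).2.2
  have hA1 : ∀ k, 1 - A k ≤ 1 := fun k => sub_le_self _ (hA k).2.1
  have hyM : ∀ k, P * (1 - A k) * P ∈ M := fun k => mul_mem (mul_mem hP.1.1 (hAM k)) hP.1.1
  have hy0 : ∀ k, 0 ≤ P * (1 - A k) * P := fun k =>
    hP.1.2.isSelfAdjoint.conjugate_nonneg (hA0 k)
  have hyt : Tendsto (fun k => ρ (P * (1 - A k) * P)) atTop (𝓝 0) := by
    refine tendsto_trace_zero_of_summable_inner hP hyM hy0 (fun k => ?_) (fun k => ?_)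
      (TopologicalSpace.denseRange_denseSeq H) fun i => ?_
    · have := proj_conjugate_mono hP.1.2 (hA1 k)
      rw [mul_one, hPi] at this
      exact this.trans hP.1.2.le_one
    · calc P * (P * (1 - A k) * P) * P = (P * P) * (1 - A k) * (P * P) := by noncomm_ring
        _ = _ := by rw [hPi]
    · refine summable_geometric_two.of_norm_bounded_eventually_nat ?_
      filter_upwards [eventually_gt_atTop i] with k hk
      rw [Real.norm_of_nonneg (re_inner_nonneg (hy0 k) _)]
      have e : ⟪u i, (P * (1 - A k) * P) (u i)⟫_ℂ = ⟪P (u i), (1 - A k) (P (u i))⟫_ℂ := by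
        have := ContinuousLinearMap.adjoint_inner_left P ((1 - A k) (P (u i))) (u i)
        rw [← ContinuousLinearMap.star_eq_adjoint, hPs] at this
        exact this.symm
      have := hAu k ⟨i, hk⟩
      rwa [← e] at this
  set x : ℕ → H →L[ℂ] H := fun k => (1 - A k) * P with hx
  have hxM : ∀ k, x k ∈ M := fun k => mul_mem (hAM k) hP.1.1
  have hxP : ∀ k, x k * P = x k := fun k => by simp only [hx]; rw [mul_assoc, hPi]
  have hAs : ∀ k, star (1 - A k) = 1 - A k := fun k => (hA0 k).isSelfAdjoint.star_eq
  have hxs : ∀ k, star (x k) = P * (1 - A k) := fun k => by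
    simp only [hx]; rw [star_mul, hPs, hAs]
  have hx1 : ∀ k, ‖x k‖ ≤ 1 := fun k => by
    have h1 : ‖1 - A k‖ ≤ 1 := (CStarAlgebra.norm_le_one_iff_of_nonneg _ (hA0 k)).2 (hA1 k)
    exact (norm_mul_le _ _).trans (mul_le_one₀ h1 (norm_nonneg _) hP.1.2.norm_le)
  have hxt : Tendsto (fun k => ρ (star (x k) * x k)) atTop (𝓝 0) := by
    refine tendsto_of_tendsto_of_tendsto_of_le_of_le tendsto_const_nhds hyt (fun _ => zero_le)
      fun k => trace_mono ρ (mul_mem (star_mem (hxM k)) (hxM k)) (hyM k)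
        (star_mul_self_nonneg _) ?_
    -- Hence x k* x k = P(1 - A k)²P is dominated by P(1 - A k)P, whose trace tends to zero.
    have h1 : (1 - A k) * (1 - A k) ≤ 1 - A k := by
      have : 0 ≤ (1 - A k) * A k := Commute.mul_nonneg (hA0 k) (hA k).2.1
        ((Commute.one_left _).sub_left (Commute.refl _))
      rw [← sub_nonneg]
      convert this using 1
      noncomm_ring
    have h2 := proj_conjugate_mono hP.1.2 h1
    rw [hxs]
    simpa only [hx, mul_assoc] using h2
  obtain ⟨hJ1, hJ2⟩ := J.tendsto_zero_of_trace hP hxM hxP hx1 hxt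
  have hlim : ∀ j, Tendsto (fun k => (1 / 2 : ℝ) ^ k + 2 * ‖T j‖ * J (star (x k))
      + 2 * ‖T j‖ * J (x k)) atTop (𝓝 0) := fun j => by
    have := ((tendsto_pow_atTop_nhds_zero_of_lt_one (r := (1 / 2 : ℝ)) (by norm_num)
      (by norm_num)).add (hJ2.const_mul (2 * ‖T j‖))).add (hJ1.const_mul (2 * ‖T j‖))
    simpa using this
  obtain ⟨k, hk⟩ := (eventually_all.2 fun j => (hlim j).eventually (gt_mem_nhds hε)).exists
  have hQ := hP.1.2.one_sub
  have hQM : 1 - P ∈ M := sub_mem (one_mem M) hP.1.1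
  have hxfin : x k ∈ finRank ρ := ⟨hxM k, P, hP, hxP k⟩
  have hQx : (1 - P) * x k ∈ finRank ρ := finRank_mul_left hQM hxfin
  -- The corrected operator differs from A k only by terms small in J, so its commutators remain
  -- small.
  have e : P + (1 - P) * A k * (1 - P) = A k + star (x k) + (1 - P) * x k := by
    have h1 : A k + P * (1 - A k) + (1 - P) * ((1 - A k) * P)
        = P + (1 - P) * A k * (1 - P) + (P - P * P) := by noncomm_ring
    rw [hxs, h1, hPi, sub_self, add_zero]
  refine ⟨P + (1 - P) * A k * (1 - P), ⟨?_, ?_, ?_⟩, ?_, fun j => ?_⟩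
  · rw [e]
    exact finRank_add (finRank_add (hA k).1 (finRank_star hxfin)) hQx
  · exact add_nonneg hP.1.2.nonneg (hQ.isSelfAdjoint.conjugate_nonneg (hA k).2.1)
  · have := proj_conjugate_mono hQ (hA k).2.2
    rw [mul_one, hQ.isIdempotentElem.eq] at this
    calc P + (1 - P) * A k * (1 - P) ≤ P + (1 - P) := add_le_add_right this P
      _ = 1 := add_sub_cancel _ _
  · rw [add_mul, hPi, mul_assoc, hP.1.2.one_sub_mul_self, mul_zero, add_zero]
  · have e2 : T j * (A k + star (x k) + (1 - P) * x k) - (A k + star (x k) + (1 - P) * x k) * T j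
        = (T j * A k - A k * T j) + (T j * star (x k) - star (x k) * T j)
          + (T j * ((1 - P) * x k) - (1 - P) * x k * T j) := by noncomm_ring
    rw [e, e2]
    have c1 := finRank_commutator (hT j) (hA k).1
    have c2 := finRank_commutator (hT j) (finRank_star hxfin)
    have c3 := finRank_commutator (hT j) hQx
    have d1 := J.add_le (finRank_add c1 c2) c3
    have d2 := J.add_le c1 c2
    have d3 := J.commutator_le (hT j) (finRank_star hxfin)
    have d4 := J.commutator_le (hT j) hQx
    have d5 : J ((1 - P) * x k) ≤ J (x k) := (J.mul_left_le hQM hxfin).trans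
      (mul_le_of_le_one_left (J.nonneg' _ (finRank_subset_L1 hxfin)) hQ.norm_le)
    have d6 : 2 * ‖T j‖ * J ((1 - P) * x k) ≤ 2 * ‖T j‖ * J (x k) := by gcongr
    have := hk j
    linarith [hAJ k j]

end Approximation

end QuasicentralModulus

/-! ### The main theorem. -/

open QuasicentralModulus

theorem proposition6p1 {H : Type*} [NormedAddCommGroup H] [InnerProductSpace ℂ H]
    [CompleteSpace H] [TopologicalSpace.SeparableSpace H]
    (M : VonNeumannAlgebra H) (ρ : QuasicentralModulus.Trace M)
    (J : QuasicentralModulus.SymmNorm ρ)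
    {n : ℕ} (T : Fin n → (H →L[ℂ] H)) (hT : ∀ j, T j ∈ M)
    (B : ℕ → (H →L[ℂ] H)) (B' : H →L[ℂ] H)
    (hB : ∀ m, B m ∈ QuasicentralModulus.finRank ρ) (hBpos : ∀ m, 0 ≤ B m)
    (hlim : Tendsto (fun m => (ContinuousLinearMapWOT.ofCLM (B m) : H →WOT[ℂ] H)) atTop
      (𝓝 (ContinuousLinearMapWOT.ofCLM B' : H →WOT[ℂ] H)))
    (hcomm : Tendsto (fun m => QuasicentralModulus.maxCommNorm J T (B m)) atTop (𝓝 0)) :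
    QuasicentralModulus.supportProj B' ∈ QuasicentralModulus.Proj M ∧
    (∀ j, T j * QuasicentralModulus.supportProj B' - QuasicentralModulus.supportProj B' * T j = 0) ∧
    QuasicentralModulus.modulus J T (QuasicentralModulus.supportProj B') = 0 := by
  have hinner : ∀ v w, Tendsto (fun m => inner ℂ w (B m v)) atTop (𝓝 (inner ℂ w (B' v))) :=
    ContinuousLinearMapWOT.tendsto_iff_forall_inner_apply_tendsto.1 hlim
  have hdual : ∀ v (f : StrongDual ℂ H), Tendsto (fun m => f (B m v)) atTop (𝓝 (f (B' v))) :=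
    ContinuousLinearMapWOT.tendsto_iff_forall_dual_apply_tendsto.1 hlim
  have hB'0 : 0 ≤ B' := nonneg_iff_inner.2 fun v =>
    ge_of_tendsto' (hinner v v) fun m => nonneg_iff_inner.1 (hBpos m) v
  have hB'M : B' ∈ M := mem_of_tendsto_inner (fun m => (hB m).1) hinner
  have hfin : ∀ j m, T j * B m - B m * T j ∈ finRank ρ := fun j m =>
    finRank_commutator (hT j) (hB m)
  have hJ : ∀ j, Tendsto (fun m => J (T j * B m - B m * T j)) atTop (𝓝 0) := by
    intro j
    have h1 : Tendsto (fun m => ENNReal.ofReal (J (T j * B m - B m * T j))) atTop (𝓝 0) :=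
      tendsto_of_tendsto_of_tendsto_of_le_of_le tendsto_const_nhds hcomm (fun _ => zero_le)
        fun m => le_iSup (fun j => ENNReal.ofReal (J (T j * B m - B m * T j))) j
    have h2 := (ENNReal.tendsto_toReal ENNReal.zero_ne_top).comp h1
    refine h2.congr fun m => ?_
    exact ENNReal.toReal_ofReal (J.nonneg' _ (finRank_subset_L1 (hfin j m)))
  have hTB' : ∀ j, Commute (T j) B' := by
    intro j
    -- The commutators with B m converge weakly to the commutator with B', and to zero in J.
    refine sub_eq_zero.1 (J.eq_zero_of_tendsto (hfin j) (fun v w => ?_) (hJ j))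
    have h1 := hinner v (ContinuousLinearMap.adjoint (T j) w)
    have h2 := hinner (T j v) w
    simpa [ContinuousLinearMap.adjoint_inner_left, inner_sub_right] using h1.sub h2
  refine ⟨supportProj_mem_Proj hB'0 hB'M,
    fun j => sub_eq_zero.2 (commute_supportProj hB'0 (hTB' j)).eq, ?_⟩
  refine le_antisymm (iSup₂_le ?_) zero_le
  rintro P ⟨hP, hPF⟩
  refine iSup₂_le ?_
  rintro Q ⟨hQ, hQ0⟩
  obtain rfl : Q = 0 := le_antisymm hQ0 hQ.1.2.nonneg
  have hFP : supportProj B' * P = P :=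
    (hP.1.2.le_iff_mul_eq_right (supportProj_isStarProjection B')).1 hPF
  refine le_of_forall_pos_le_add fun ε hε => ?_
  rw [zero_add]
  rcases eq_or_ne ε ∞ with rfl | hε'
  · exact le_top
  obtain ⟨A, hA, hAP, hAJ⟩ := exists_finRankPosContr_eq_one_on J hT hP hFP
    (fun N ξ hξ δ hδ => exists_finRankPosContr_approx J hT hB hBpos hB'0 hdual hJ ξ hξ hδ)
    (ENNReal.toReal_pos hε.ne' hε')
  refine (iInf₂_le A ⟨hA, hAP, mul_zero A⟩).trans (iSup_le fun j => ?_)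
  exact ENNReal.ofReal_le_of_le_toReal (hAJ j)
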